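/- Let $n\ge 2$ and $N\ge 2$ be integers and let $a_k>0$, $\beta_k$, $d_k$ ($k=1,\dots,N$) be real numbers with $\sum_{k=1}^N a_k=1$ and $\sum_{k=1}^N a_k|d_k|^2<1$. Put $\alpha_0=0$, $\alpha_k=\alpha_{k-1}+a_k$. Let $P\in L_2[0,1]$ be the (real) self-similar function with these parameters, i.e. the unique solution of $$P(x)=\beta_k+d_k\,P\!\left(\frac{x-\alpha_{k-1}}{a_k}\right)\quad\text{for a.e. }x\in(\alpha_{k-1},\alpha_k),\qquad k=1,\dots,N.$$ Suppose that there is an index $m\in\{1,\dots,N\}$ with $d_m<0$ and $d_k=0$ for all $k\ne m$. Let $\rho=P'$ be the generalized derivative of $P$, and consider the boundary value problem $$(-1)^n y^{(2n)}-\lambda\rho y=0,\qquad y^{(k)}(0)=y^{(k)}(1)=0,\quad 0\le k<n,$$ understood in the weak sense: $\lambda$ is an eigenvalue if there is a non-zero $y$ in the Sobolev space $\mathfrak H$ of functions of order $n$ on $[0,1]$ satisfying the boundary conditions ($y,\dots,y^{(n-1)}$ absolutely continuous, $y^{(n)}\in L_2[0,1]$) such that $$\int_0^1\left(y^{(n)}\overline{z^{(n)}}+\lambda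 P\,(y\overline z)'\right)dx=0\quad\text{for all }z\in\mathfrak H,$$ and its multiplicity is the dimension of the space of such $y$. For $k=1,\dots,N-1$ put $$\zeta_k=\begin{cases}\beta_m-\beta_{m-1}+d_m\beta_1,&k=m-1,\\ \beta_{m+1}-\beta_m-d_m\beta_N,&k=m,\\ \beta_{k+1}-\beta_k,&\text{otherwise,}\end{cases}\qquad \mathrm Z_\pm=\#\{k\in\{1,\dots,N-1\}:\pm\zeta_k>0\}.$$ Suppose that $\mathrm Z_++\mathrm Z_-=N-1$. Then the problem has infinitely many positive and infinitely many negative eigenvalues; the positive ones can be numbered in increasing order, $\lambda_1\le\lambda_2\le\cdots$, and the negative ones in decreasing order, $\lambda_{-1}\ge\lambda_{-2}\ge\cdots$, both counted with multiplicity, and there are real numbers $\tau_l>0$, $l=1,\dots,N-1$, such that for every $l=1,\dots,N-1$, as $k\to\infty$, $$\lambda_{l+k(N-1)}=\tau_l\,(a_m^{2n-1}|d_m|)^{-2k}\,(1+o(1)),\qquad \lambda_{-(l+\mathrm Z_-+k(N-1))}=-\tau_l\,(a_m^{2n-1}|d_m|)^{-2k-1}\,(1+o(1)).$$ -/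

import Mathlib

open MeasureTheory Set Filter Topology Asymptotics

noncomputable section

/-! ### Self-similar functions -/

/-- Lebesgue measure on `[0, 1]`. -/
abbrev unitMeasure : Measure ℝ := volume.restrict (Icc (0 : ℝ) 1)

/-- The partition points `α_k = a_1 + ⋯ + a_k` (so `α_0 = 0`). -/
def breakpoint (a : ℕ → ℝ) (k : ℕ) : ℝ := ∑ i ∈ Finset.Icc 1 k, a i

/-- The similarity operator
`G(f) = ∑_{k=1}^N (β_k χ_{(α_{k-1}, α_k)} + d_k G_k(f))`, where
`G_k(f)(x) = f((x - α_{k-1}) / a_k)` on `(α_{k-1}, α_k)` and `G_k(f) = 0` elsewhere. -/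
def similarityOp (N : ℕ) (a β d : ℕ → ℝ) (f : ℝ → ℝ) (x : ℝ) : ℝ :=
  ∑ k ∈ Finset.Icc 1 N,
    (Ioo (breakpoint a (k - 1)) (breakpoint a k)).indicator
      (fun t => β k + d k * f ((t - breakpoint a (k - 1)) / a k)) x

/-- The quantities `ζ_k`, `k = 1, …, N - 1`. -/
def zetaCoeff (N m : ℕ) (β d : ℕ → ℝ) (k : ℕ) : ℝ :=
  if k + 1 = m then β m - β (m - 1) + d m * β 1
  else if k = m then β (m + 1) - β m - d m * β N
  else β (k + 1) - β k

/-- `Z_+`, the number of `k ∈ [1, N - 1]` with `ζ_k > 0`. -/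
def numPos (N m : ℕ) (β d : ℕ → ℝ) : ℕ :=
  {k ∈ Finset.Icc 1 (N - 1) | 0 < zetaCoeff N m β d k}.card

/-- `Z_-`, the number of `k ∈ [1, N - 1]` with `ζ_k < 0`. -/
def numNeg (N m : ℕ) (β d : ℕ → ℝ) : ℕ :=
  {k ∈ Finset.Icc 1 (N - 1) | zetaCoeff N m β d k < 0}.card

/-! ### The energy space and the spectral problem -/

/-- The Sobolev space of order `n ≥ 1` on `[0, 1]` with the boundary conditions
`y^{(k)}(0) = y^{(k)}(1) = 0` for `0 ≤ k < n`. Its elements are represented by their continuous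
representatives, extended by zero to the line: `y` belongs to the space if and only if this
extension is `C^{n-1}` (which for a function of class `C^{n-1}` on `[0, 1]` says exactly that the
boundary conditions hold) and `y^{(n-1)}` is on `[0, 1]` an absolutely continuous function
whose derivative `g` is square integrable. Almost everywhere on `[0, 1]` one then has
`g = iteratedDeriv n y`. -/
def sobolevZero (n : ℕ) : Submodule ℂ (ℝ → ℂ) where
  carrier := {y | (∀ x ∉ Ioo (0 : ℝ) 1, y x = 0) ∧ ContDiff ℝ ((n - 1 : ℕ) : WithTop ℕ∞) y ∧
    ∃ g : ℝ → ℂ, MemLp g 2 unitMeasure ∧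
      ∀ x ∈ Icc (0 : ℝ) 1, iteratedDeriv (n - 1) y x = ∫ t in (0 : ℝ)..x, g t}
  zero_mem' := by
    refine ⟨fun _ _ => rfl, contDiff_const, 0, MemLp.zero, fun x _ => ?_⟩
    simp
  add_mem' := by
    rintro y z ⟨hy0, hy, g, hg, hyg⟩ ⟨hz0, hz, h, hh, hzh⟩
    refine ⟨fun x hx => by simp [hy0 x hx, hz0 x hx], hy.add hz, g + h, hg.add hh,
      fun x hx => ?_⟩
    have hsub : Ioc 0 x ⊆ Icc (0 : ℝ) 1 := fun t ht => ⟨ht.1.le, ht.2.trans hx.2⟩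
    have key : ∀ {u : ℝ → ℂ}, MemLp u 2 unitMeasure → IntervalIntegrable u volume 0 x :=
      fun hu => (intervalIntegrable_iff_integrableOn_Ioc_of_le hx.1).2
        (IntegrableOn.mono_set (hu.integrable (by norm_num)) hsub)
    rw [iteratedDeriv_add hy.contDiffAt hz.contDiffAt, hyg x hx, hzh x hx]
    exact (intervalIntegral.integral_add (key hg) (key hh)).symm
  smul_mem' := by
    rintro c y ⟨hy0, hy, g, hg, hyg⟩
    refine ⟨fun x hx => by simp [hy0 x hx], hy.const_smul c, c • g, hg.const_smul c,
      fun x hx => ?_⟩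
    rw [iteratedDeriv_const_smul_field, hyg x hx]
    exact (intervalIntegral.integral_smul c g).symm

/-- The form `⟨J⁺ T_ρ(lam) y, z⟩ = ∫₀¹ (y^{(n)} z̄^{(n)} + lam P (y z̄)') dx`, whose restriction to
the diagonal is `∫₀¹ (|y^{(n)}|² + lam P (|y|²)') dx`; here `ρ = P'`. -/
def pencilForm (n : ℕ) (P : Lp ℝ 2 unitMeasure) (lam : ℂ) (y z : ℝ → ℂ) : ℂ :=
  ∫ x in Icc (0 : ℝ) 1,
    (iteratedDeriv n y x * starRingEnd ℂ (iteratedDeriv n z x) +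
      lam * ((P x : ℝ) : ℂ) * deriv (fun t => y t * starRingEnd ℂ (z t)) x)

theorem sobolevZero_contDiff {n : ℕ} (hn : 2 ≤ n) {y : ℝ → ℂ} (hy : y ∈ sobolevZero n) :
    ContDiff ℝ 1 y :=
  hy.2.1.of_le (by exact_mod_cast (by omega : 1 ≤ n - 1))

theorem sobolevZero_ae_hasDerivAt {n : ℕ} {y : ℝ → ℂ} (hy : y ∈ sobolevZero n) :
    ∃ g : ℝ → ℂ, MemLp g 2 unitMeasure ∧
      ∀ᵐ x ∂unitMeasure, HasDerivAt (iteratedDeriv (n - 1) y) (g x) x := by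
  obtain ⟨-, -, g, hg, hyg⟩ := hy
  refine ⟨g, hg, ?_⟩
  have hi : IntervalIntegrable g volume 0 1 :=
    (intervalIntegrable_iff_integrableOn_Icc_of_le zero_le_one).2 (hg.integrable (by norm_num))
  have h0 : ∀ᵐ x : ℝ, x ≠ 0 := by simp [ae_iff, measure_singleton]
  have h1 : ∀ᵐ x : ℝ, x ≠ 1 := by simp [ae_iff, measure_singleton]
  rw [ae_restrict_iff' measurableSet_Icc]
  filter_upwards [hi.ae_hasDerivAt_integral, h0, h1] with x hx hx0 hx1 hxm
  have hd := hx (by rwa [uIcc_of_le zero_le_one]) 0 (by simp)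
  refine hd.congr_of_eventuallyEq ?_
  filter_upwards [Icc_mem_nhds (lt_of_le_of_ne hxm.1 hx0.symm) (lt_of_le_of_ne hxm.2 hx1)]
    with t ht using hyg t ht

theorem iteratedDeriv_eq_deriv_pred {n : ℕ} (hn : 2 ≤ n) (y : ℝ → ℂ) :
    iteratedDeriv n y = deriv (iteratedDeriv (n - 1) y) := by
  obtain ⟨k, rfl⟩ : ∃ k, n = k + 1 := ⟨n - 1, by omega⟩
  simpa using iteratedDeriv_succ (n := k) (f := y)

theorem sobolevZero_memLp {n : ℕ} (hn : 2 ≤ n) {y : ℝ → ℂ} (hy : y ∈ sobolevZero n) :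
    MemLp (iteratedDeriv n y) 2 unitMeasure := by
  obtain ⟨g, hg, h⟩ := sobolevZero_ae_hasDerivAt hy
  refine hg.ae_eq ?_
  filter_upwards [h] with x hx
  rw [iteratedDeriv_eq_deriv_pred hn, hx.deriv]

theorem sobolevZero_iteratedDeriv_add {n : ℕ} (hn : 2 ≤ n) {y z : ℝ → ℂ}
    (hy : y ∈ sobolevZero n) (hz : z ∈ sobolevZero n) :
    ∀ᵐ x ∂unitMeasure,
      iteratedDeriv n (y + z) x = iteratedDeriv n y x + iteratedDeriv n z x := by
  obtain ⟨g, -, hg⟩ := sobolevZero_ae_hasDerivAt hy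
  obtain ⟨h, -, hh⟩ := sobolevZero_ae_hasDerivAt hz
  filter_upwards [hg, hh] with x h1 h2
  have he : iteratedDeriv (n - 1) (y + z) = iteratedDeriv (n - 1) y + iteratedDeriv (n - 1) z :=
    funext fun t => iteratedDeriv_add hy.2.1.contDiffAt hz.2.1.contDiffAt
  simp only [iteratedDeriv_eq_deriv_pred hn, he]
  rw [(h1.add h2).deriv, h1.deriv, h2.deriv]

theorem contDiff_mul_conj {y z : ℝ → ℂ} (hy : ContDiff ℝ 1 y) (hz : ContDiff ℝ 1 z) :
    ContDiff ℝ 1 (fun t => y t * starRingEnd ℂ (z t)) :=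
  hy.mul (Complex.conjCLE.contDiff.comp hz)

theorem pencilForm_integrable {n : ℕ} (hn : 2 ≤ n) (P : Lp ℝ 2 unitMeasure) (lam : ℂ)
    {y z : ℝ → ℂ} (hy : y ∈ sobolevZero n) (hz : z ∈ sobolevZero n) :
    Integrable (fun x => iteratedDeriv n y x * starRingEnd ℂ (iteratedDeriv n z x) +
      lam * ((P x : ℝ) : ℂ) * deriv (fun t => y t * starRingEnd ℂ (z t)) x) unitMeasure := by
  refine Integrable.add ?_ ?_
  · exact (sobolevZero_memLp hn hy).integrable_mul (sobolevZero_memLp hn hz).star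
  · have hP : Integrable (fun x => lam * ((P x : ℝ) : ℂ)) unitMeasure :=
      (((Lp.memLp P).integrable (by norm_num)).ofReal).const_mul lam
    have hc : Continuous (deriv (fun t => y t * starRingEnd ℂ (z t))) :=
      (contDiff_mul_conj (sobolevZero_contDiff hn hy)
        (sobolevZero_contDiff hn hz)).continuous_deriv le_rfl
    exact IntegrableOn.mul_continuousOn hP hc.continuousOn isCompact_Icc

/-- The space of solutions of the problem `(-1)^n y^{(2n)} - lam ρ y = 0`,
`y^{(k)}(0) = y^{(k)}(1) = 0` for `0 ≤ k < n`, where `ρ = P'`: the kernel of the pencil `T_ρ` at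
the point `lam`. -/
def eigenspaceOf (n : ℕ) (hn : 2 ≤ n) (P : Lp ℝ 2 unitMeasure) (lam : ℂ) :
    Submodule ℂ (ℝ → ℂ) where
  carrier := {y | y ∈ sobolevZero n ∧ ∀ z ∈ sobolevZero n, pencilForm n P lam y z = 0}
  zero_mem' := by
    refine ⟨zero_mem _, fun z _ => ?_⟩
    simp [pencilForm]
  add_mem' := by
    rintro u v ⟨hu, hu'⟩ ⟨hv, hv'⟩
    refine ⟨add_mem hu hv, fun z hz => ?_⟩
    have hs : pencilForm n P lam (u + v) z = pencilForm n P lam u z + pencilForm n P lam v z := by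
      unfold pencilForm
      rw [← integral_add (pencilForm_integrable hn P lam hu hz)
        (pencilForm_integrable hn P lam hv hz)]
      refine integral_congr_ae ?_
      filter_upwards [sobolevZero_iteratedDeriv_add hn hu hv] with x hx
      have hz1 := sobolevZero_contDiff hn hz
      have d1 := ((contDiff_mul_conj (sobolevZero_contDiff hn hu) hz1).differentiable
        one_ne_zero) x
      have d2 := ((contDiff_mul_conj (sobolevZero_contDiff hn hv) hz1).differentiable
        one_ne_zero) x
      have e : (fun t => (u + v) t * starRingEnd ℂ (z t)) =
          (fun t => u t * starRingEnd ℂ (z t)) + fun t => v t * starRingEnd ℂ (z t) :=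
        funext fun t => by simp [add_mul]
      rw [hx, e, deriv_add d1 d2]
      ring
    rw [hs, hu' z hz, hv' z hz, add_zero]
  smul_mem' := by
    rintro c u ⟨hu, hu'⟩
    refine ⟨Submodule.smul_mem _ c hu, fun z hz => ?_⟩
    have hs : pencilForm n P lam (c • u) z = c * pencilForm n P lam u z := by
      unfold pencilForm
      rw [← integral_const_mul]
      refine integral_congr_ae (Eventually.of_forall fun x => ?_)
      have e : (fun t => (c • u) t * starRingEnd ℂ (z t)) =
          fun t => c * (u t * starRingEnd ℂ (z t)) := funext fun t => by simp [mul_assoc]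
      simp only [iteratedDeriv_const_smul_field, e, deriv_const_mul_field, smul_eq_mul]
      ring
    rw [hs, hu' z hz, mul_zero]

/-- The multiplicity of `t` as an eigenvalue of the problem (zero if `t` is not an eigenvalue). -/
def eigenMult (n : ℕ) (hn : 2 ≤ n) (P : Lp ℝ 2 unitMeasure) (t : ℝ) : ℕ∞ :=
  Cardinal.toENat (Module.rank ℂ (eigenspaceOf n hn P (t : ℂ)))

/-- `ev` numbers the real eigenvalues with multiplicity: `ev 1 ≤ ev 2 ≤ ⋯` are the positive ones
and `ev (-1) ≥ ev (-2) ≥ ⋯` are the negative ones, both sequences being infinite, and every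
`t ≠ 0` occurs as many times as its multiplicity says. (The value `ev 0` plays no role; the number
`0` is never an eigenvalue.) -/
structure IsEigenvalueNumbering (n : ℕ) (hn : 2 ≤ n) (P : Lp ℝ 2 unitMeasure) (ev : ℤ → ℝ) :
    Prop where
  pos : ∀ k : ℤ, 1 ≤ k → 0 < ev k
  neg : ∀ k : ℤ, k ≤ -1 → ev k < 0
  mono_pos : MonotoneOn ev (Ici 1)
  mono_neg : MonotoneOn ev (Iic (-1))
  count : ∀ t : ℝ, t ≠ 0 → {k : ℤ | k ≠ 0 ∧ ev k = t}.encard = eigenMult n hn P t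

end

/-! The problem is recast as a spectral problem for one bounded symmetric operator. With `g = y^(n)`
as the unknown, the energy space becomes the Hilbert space `momentFree n`, on which the form `⟨P',
ȳz⟩` is represented by `T = weightOp`. A real `λ ≠ 0` is an eigenvalue exactly when `1/λ` is an
eigenvalue of `T`, with equal eigenspaces up to isomorphism (`eigenspaceOf_eq_map`). Positive
eigenvalues are thus characteristic values of `T`, negative ones those of `-T` with the sign
changed.

Let `S` be the affine map of `[0, 1]` onto the `m`-th interval. As only `d m` is non-zero, `⟨P', f⟩
= ∑ ζ_k f(α_k) + d_m ⟨P', f ∘ S⟩` (`jumpForm_eq`): `P'` is `N - 1` point masses plus a negative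
multiple of a shrunken copy of itself. Take `u = w ∘ S⁻¹ + ∑ c_k φ_k` with narrow bumps `φ_k` at
`α_k`. Then the form of `u` is `d_m` times the form of `w` plus `∑ ζ_k |c_k|²`
(`exists_diagonalizing`), while `w ↦ w ∘ S⁻¹` multiplies the squared norm by `a_m^(-(2n-1))`
(`norm_shrinkOp_sq`).

Put `q = a_m^(2n-1) |d_m| < 1` and let `N_±(R)` count the characteristic values of `±T` in `(0, R)`.
Trial vectors `u` with `w` in a spectral subspace of `T` and `c` carried by `ζ_k < 0` give `N_+(q(R
- C)) + Z_- ≤ N_-(R)`; symmetrically `N_-(q(R - C)) + Z_+ ≤ N_+(R)` (`exists_charCount_le`). The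
non-orthogonality of the two summands of `u` costs only the shift `C`. Hence the normalized
sequences `λ_{l+k(N-1)} q^(2k)` and `-λ_{-(l+Z_-+k(N-1))} q^(2k+1)`, interleaved, decrease up to
geometrically small errors and have a common limit `τ_l` (`exists_tendsto_of_interlaced`).

No sharp reverse inequality is needed, only `τ_l > 0`. For this, let `y` vanish at the positive
point masses of the first `2k` generations, and to order `n` at one further point. These are `k(N-1)
+ n` conditions, and on their kernel the form is at most `B q^(2k) ‖·‖²` (`exists_codim_form_le`).
-/

noncomputable section

/-! ### Min-max principle for symmetric operators with small tails. -/

/-- A bounded operator whose form is arbitrarily small on subspaces of finite codimension. -/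
def HasSmallTails {E : Type*} [NormedAddCommGroup E] [InnerProductSpace ℂ E] (T : E →L[ℂ] E) :
    Prop :=
  ∀ ε : ℝ, 0 < ε → ∃ (J : Type) (_ : Fintype J) (A : E →ₗ[ℂ] (J → ℂ)), ∀ x ∈ LinearMap.ker A,
    ∀ y ∈ LinearMap.ker A, ‖inner ℂ (T x) y‖ ≤ ε * ‖x‖ * ‖y‖

/-- The sum of the eigenspaces of `T` with real eigenvalues in `S`. -/
def spectralSum {E : Type*} [NormedAddCommGroup E] [InnerProductSpace ℂ E] (T : E →L[ℂ] E)
    (S : Set ℝ) : Submodule ℂ E :=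
  ⨆ μ : S, Module.End.eigenspace (T : Module.End ℂ E) (((μ : ℝ)) : ℂ)

section Spectral

variable {E : Type*} [NormedAddCommGroup E] [InnerProductSpace ℂ E] {T : E →L[ℂ] E}

theorem HasSmallTails.neg (h : HasSmallTails T) : HasSmallTails (-T) := by
  intro ε hε
  obtain ⟨J, hJ, A, hA⟩ := h ε hε
  exact ⟨J, hJ, A, fun x hx y hy => by simpa using hA x hx y hy⟩

theorem HasSmallTails.exists_codim (h : HasSmallTails T) {ε : ℝ} (hε : 0 < ε) :
    ∃ (J : Type) (_ : Fintype J) (A : E →ₗ[ℂ] (J → ℂ)), ∀ x ∈ LinearMap.ker A,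
      (inner ℂ (T x) x).re ≤ ε * ‖x‖ ^ 2 := by
  obtain ⟨J, hJ, A, hA⟩ := h ε hε
  refine ⟨J, hJ, A, fun x hx => ?_⟩
  calc (inner ℂ (T x) x).re ≤ ‖inner ℂ (T x) x‖ := Complex.re_le_norm _
    _ ≤ ε * ‖x‖ * ‖x‖ := hA x hx x hx
    _ = _ := by ring

/-- An operator with small tails is compact. -/
theorem HasSmallTails.isCompactOperator [CompleteSpace E] (h : HasSmallTails T) :
    IsCompactOperator T := by
  have key : T ∈ closure {f : E →L[ℂ] E | IsCompactOperator f} := by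
    rw [Metric.mem_closure_iff]
    intro ε hε
    obtain ⟨J, hJ, A, hA⟩ := h (ε / 2) (by positivity)
    set Y := LinearMap.ker A with hY
    -- `A` is not assumed continuous, so `Y` need not be closed; the bound passes to its closure
    -- `Yᗮᗮ` by continuity.
    have hclos : ∀ x ∈ Yᗮᗮ, ∀ y ∈ Yᗮᗮ, ‖inner ℂ (T x) y‖ ≤ ε / 2 * ‖x‖ * ‖y‖ := by
      rw [Submodule.orthogonal_orthogonal_eq_closure]
      have h1 : ∀ x ∈ Y, ∀ y ∈ closure (Y : Set E),
          ‖inner ℂ (T x) y‖ ≤ ε / 2 * ‖x‖ * ‖y‖ := by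
        intro x hx
        have hc : IsClosed {y : E | ‖inner ℂ (T x) y‖ ≤ ε / 2 * ‖x‖ * ‖y‖} :=
          isClosed_le (by fun_prop) (by fun_prop)
        exact fun y hy => closure_minimal (fun y hy => hA x hx y hy) hc hy
      intro x hx y hy
      have hc : IsClosed {x : E | ‖inner ℂ (T x) y‖ ≤ ε / 2 * ‖x‖ * ‖y‖} :=
        isClosed_le (by fun_prop) (by fun_prop)
      exact closure_minimal (fun x hx => h1 x hx y hy) hc hx
    have hfin : FiniteDimensional ℂ Yᗮ := by
      refine FiniteDimensional.of_injective (A.comp (Yᗮ).subtype) ?_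
      rw [← LinearMap.ker_eq_bot, LinearMap.ker_eq_bot']
      rintro ⟨x, hx⟩ hx0
      have hx1 : x ∈ Y := by simpa [hY] using hx0
      ext
      exact inner_self_eq_zero.1 (hx x hx1)
    let p : E →L[ℂ] E := (Yᗮ).starProjection
    have hpc : IsCompactOperator p := by
      have : IsCompactOperator (Yᗮ).orthogonalProjectionOnto := by
        have : LocallyCompactSpace Yᗮ :=
          have := FiniteDimensional.proper ℂ Yᗮ
          inferInstance
        exact isCompactOperator_of_locallyCompactSpace_dom (Yᗮ).orthogonalProjectionOnto
      exact this.clm_comp (Yᗮ).subtypeL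
    have hq : ∀ x, x - p x ∈ Yᗮᗮ := fun x => (Yᗮ).sub_starProjection_mem_orthogonal x
    have hqn : ∀ x, ‖x - p x‖ ≤ ‖x‖ := fun x => by
      have hx := (Yᗮ).norm_sq_eq_add_norm_sq_starProjection x
      have he : (Yᗮᗮ).starProjection x = x - p x := by
        simp [Submodule.starProjection_orthogonal, p]
      rw [he] at hx
      nlinarith [norm_nonneg x, norm_nonneg (x - p x), sq_nonneg ‖p x‖,
        sq_nonneg ‖(Yᗮ).starProjection x‖]
    -- With this choice `T - F = (1 - p) T (1 - p)`, and `1 - p` maps into `Yᗮᗮ`, where the form is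
    -- small.
    let F : E →L[ℂ] E := p.comp T + ((ContinuousLinearMap.id ℂ E - p).comp T).comp p
    refine ⟨F, ?_, ?_⟩
    · exact (hpc.comp_clm T).add (hpc.clm_comp ((ContinuousLinearMap.id ℂ E - p).comp T))
    · rw [dist_eq_norm]
      refine lt_of_le_of_lt (ContinuousLinearMap.opNorm_le_bound _ (by positivity : 0 ≤ ε / 2)
        fun x => ?_) (by linarith)
      have hz : (T - F) x = T (x - p x) - p (T (x - p x)) := by
        simp [F]
        abel
      rw [hz]
      set w := x - p x with hw
      have h1 : ‖T w - p (T w)‖ ^ 2 ≤ ε / 2 * ‖w‖ * ‖T w - p (T w)‖ := by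
        have h2 : inner ℂ (T w) (T w - p (T w)) = inner ℂ (T w - p (T w)) (T w - p (T w)) := by
          rw [inner_sub_left (T w)]
          have : inner ℂ (p (T w)) (T w - p (T w)) = 0 :=
            (hq (T w)) _ ((Yᗮ).starProjection_apply_mem _)
          rw [this, sub_zero]
        have h3 := hclos w (hq x) _ (hq (T w))
        rw [h2, inner_self_eq_norm_sq_to_K] at h3
        simpa using h3
      have h2 := hqn x
      by_cases h0 : ‖T w - p (T w)‖ = 0
      · rw [h0]; positivity
      · have h4 : 0 < ‖T w - p (T w)‖ := lt_of_le_of_ne (norm_nonneg _) (Ne.symm h0)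
        have h5 : ‖T w - p (T w)‖ ≤ ε / 2 * ‖w‖ := by
          rw [pow_two] at h1
          exact le_of_mul_le_mul_right h1 h4
        exact h5.trans (by gcongr)
  have hc := isClosed_setOfPred_isCompactOperator (𝕜₁ := ℂ) (𝕜₂ := ℂ) (σ₁₂ := RingHom.id ℂ)
    (M₁ := E) (M₂ := E)
  rw [hc.closure_eq] at key
  exact key

theorem orthogonalFamily_real_eigenspaces (hT : (T : E →ₗ[ℂ] E).IsSymmetric) :
    OrthogonalFamily ℂ
      (fun μ : ℝ => Module.End.eigenspace (T : Module.End ℂ E) (μ : ℂ))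
      fun μ => (Module.End.eigenspace (T : Module.End ℂ E) (μ : ℂ)).subtypeₗᵢ :=
  hT.orthogonalFamily_eigenspaces.comp Complex.ofReal_injective

/-- Expansion of an element of a spectral sum in eigenvectors. -/
theorem exists_expansion_of_mem_spectralSum (hT : (T : E →ₗ[ℂ] E).IsSymmetric) {S : Set ℝ} {x : E}
    (hx : x ∈ spectralSum T S) : ∃ (s : Finset ℝ) (c : ℝ → ℝ), (∀ μ ∈ s, μ ∈ S) ∧
      (∀ μ, 0 ≤ c μ) ∧ ‖x‖ ^ 2 = ∑ μ ∈ s, c μ ∧ (inner ℂ (T x) x).re = ∑ μ ∈ s, μ * c μ := by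
  classical
  obtain ⟨s, hs⟩ := (Submodule.mem_iSup_iff_exists_finset).1 hx
  obtain ⟨v, rfl⟩ := (Submodule.mem_iSup_finset_iff_exists_sum _ _).1 hs
  have hO : OrthogonalFamily ℂ
      (fun μ : S => Module.End.eigenspace (T : Module.End ℂ E) (((μ : ℝ)) : ℂ))
      fun μ => (Module.End.eigenspace (T : Module.End ℂ E) (((μ : ℝ)) : ℂ)).subtypeₗᵢ :=
    (orthogonalFamily_real_eigenspaces hT).comp Subtype.coe_injective
  refine ⟨s.map (Function.Embedding.subtype _), fun μ => if h : μ ∈ S then ‖v ⟨μ, h⟩‖ ^ 2 else 0,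
    by simp +contextual, fun μ => by dsimp only; split_ifs <;> positivity, ?_, ?_⟩
  · rw [Finset.sum_map]
    refine (hO.norm_sum v s).trans (Finset.sum_congr rfl fun μ _ => ?_)
    simp
    rfl
  · rw [Finset.sum_map]
    have h1 : T (∑ μ ∈ s, (v μ : E)) = ∑ μ ∈ s, (((μ : ℝ) : ℂ) • v μ : E) := by
      rw [map_sum]
      exact Finset.sum_congr rfl fun μ _ => Module.End.mem_eigenspace_iff.1 (v μ).2
    have h2 := hO.inner_sum (fun μ => ((μ : ℝ) : ℂ) • v μ) v s
    rw [h1]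
    have h3 : inner ℂ (∑ μ ∈ s, (((μ : ℝ) : ℂ) • v μ : E)) (∑ μ ∈ s, (v μ : E))
        = ∑ μ ∈ s, inner ℂ (((μ : ℝ) : ℂ) • v μ) (v μ) := h2
    rw [h3, Complex.re_sum]
    refine Finset.sum_congr rfl fun μ _ => ?_
    rw [inner_smul_left, inner_self_eq_norm_sq_to_K]
    simp [← Complex.ofReal_pow, -mul_eq_mul_left_iff]
    rfl

theorem le_form_of_mem_spectralSum (hT : (T : E →ₗ[ℂ] E).IsSymmetric) {S : Set ℝ} {t : ℝ}
    (hS : ∀ μ ∈ S, t < μ) {x : E} (hx : x ∈ spectralSum T S) (hx0 : x ≠ 0) :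
    t * ‖x‖ ^ 2 < (inner ℂ (T x) x).re := by
  obtain ⟨s, c, hs, hc, h1, h2⟩ := exists_expansion_of_mem_spectralSum hT hx
  have hpos : 0 < ∑ μ ∈ s, c μ := h1 ▸ by positivity
  obtain ⟨μ, hμ, hμ0⟩ := Finset.exists_ne_zero_of_sum_ne_zero hpos.ne'
  rw [h1, h2, Finset.mul_sum]
  refine Finset.sum_lt_sum (fun ν hν => mul_le_mul_of_nonneg_right (hS ν (hs ν hν)).le (hc ν))
    ⟨μ, hμ, mul_lt_mul_of_pos_right (hS μ (hs μ hμ)) (lt_of_le_of_ne (hc μ) (Ne.symm hμ0))⟩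

theorem form_le_of_mem_spectralSum (hT : (T : E →ₗ[ℂ] E).IsSymmetric) {S : Set ℝ} {t : ℝ}
    (hS : ∀ μ ∈ S, μ ≤ t) {x : E} (hx : x ∈ spectralSum T S) :
    (inner ℂ (T x) x).re ≤ t * ‖x‖ ^ 2 := by
  obtain ⟨s, c, hs, hc, h1, h2⟩ := exists_expansion_of_mem_spectralSum hT hx
  rw [h1, h2, Finset.mul_sum]
  exact Finset.sum_le_sum fun ν hν => mul_le_mul_of_nonneg_right (hS ν (hs ν hν)) (hc ν)

/-- The spectral subspace meets `ker A` only in zero, because the form exceeds `t ‖x‖²` on the one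
and not on the other; so `A` embeds it in `F`. -/
theorem finrank_spectralSum_le (hT : (T : E →ₗ[ℂ] E).IsSymmetric) {F : Type*} [AddCommGroup F]
    [Module ℂ F] [FiniteDimensional ℂ F] {t : ℝ} (A : E →ₗ[ℂ] F)
    (hA : ∀ x ∈ LinearMap.ker A, (inner ℂ (T x) x).re ≤ t * ‖x‖ ^ 2) :
    FiniteDimensional ℂ (spectralSum T (Ioi t)) ∧
      Module.finrank ℂ (spectralSum T (Ioi t)) ≤ Module.finrank ℂ F := by
  have hinj : Function.Injective (A.comp (spectralSum T (Ioi t)).subtype) := by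
    rw [← LinearMap.ker_eq_bot, LinearMap.ker_eq_bot']
    rintro ⟨x, hx⟩ hx0
    by_contra hne
    have h0 : x ≠ 0 := fun h => hne (by simp [h])
    have := le_form_of_mem_spectralSum hT (fun μ hμ => hμ) hx h0
    exact absurd (hA x (by simpa using hx0)) (not_le.2 this)
  exact ⟨FiniteDimensional.of_injective _ hinj, LinearMap.finrank_le_finrank_of_injective hinj⟩

theorem HasSmallTails.finiteDimensional (h : HasSmallTails T)
    (hT : (T : E →ₗ[ℂ] E).IsSymmetric) {t : ℝ} (ht : 0 < t) :
    FiniteDimensional ℂ (spectralSum T (Ioi t)) := by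
  obtain ⟨J, hJ, A, hA⟩ := h.exists_codim ht
  exact (finrank_spectralSum_le hT A hA).1

/-- Eigenvalues of a symmetric operator are real, so each lies on one side of `t`. -/
theorem iSup_eigenspaces_le (hT : (T : E →ₗ[ℂ] E).IsSymmetric) (t : ℝ) :
    (⨆ μ, Module.End.eigenspace (T : Module.End ℂ E) μ) ≤
      spectralSum T (Ioi t) ⊔ spectralSum T (Iic t) := by
  refine iSup_le fun μ => ?_
  by_cases hμ : Module.End.HasEigenvalue (T : Module.End ℂ E) μ
  · have hr : ((μ.re : ℝ) : ℂ) = μ := Complex.conj_eq_iff_re.1 (hT.conj_eigenvalue_eq_self hμ)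
    rcases lt_or_ge t μ.re with h | h
    · refine le_trans ?_ le_sup_left
      rw [← hr]
      exact le_iSup (fun μ : Ioi t => Module.End.eigenspace (T : Module.End ℂ E) (((μ : ℝ)) : ℂ))
        ⟨μ.re, h⟩
    · refine le_trans ?_ le_sup_right
      rw [← hr]
      exact le_iSup (fun μ : Iic t => Module.End.eigenspace (T : Module.End ℂ E) (((μ : ℝ)) : ℂ))
        ⟨μ.re, h⟩
  · rw [Module.End.hasEigenvalue_iff, not_not] at hμ
    rw [hμ]; exact bot_le

/-- On the orthogonal complement of the spectral subspace the form is bounded by `t`. -/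
theorem form_le_of_mem_orthogonal [CompleteSpace E] (h : HasSmallTails T)
    (hT : (T : E →ₗ[ℂ] E).IsSymmetric) {t : ℝ} (ht : 0 < t) {x : E}
    (hx : x ∈ (spectralSum T (Ioi t))ᗮ) : (inner ℂ (T x) x).re ≤ t * ‖x‖ ^ 2 := by
  have := h.finiteDimensional hT ht
  set U := spectralSum T (Ioi t) with hU
  have hdense : x ∈ closure ((⨆ μ, Module.End.eigenspace (T : Module.End ℂ E) μ : Submodule ℂ E) :
      Set E) := by
    have h1 := ContinuousLinearMap.orthogonalComplement_iSup_eigenspaces_eq_bot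
      h.isCompactOperator hT
    rw [← Submodule.topologicalClosure_eq_top_iff] at h1
    have : x ∈ (⨆ μ, Module.End.eigenspace (T : Module.End ℂ E) μ).topologicalClosure := by
      rw [h1]; trivial
    exact this
  have hW : x ∈ closure (spectralSum T (Iic t) : Set E) := by
    -- The map `y ↦ y - U.starProjection y` fixes `x` and strips a finite sum of eigenvectors of its
    -- components with eigenvalue above `t`.
    have hcont : Continuous fun y : E => y - U.starProjection y := by fun_prop
    have hx' : x - U.starProjection x = x := by
      rw [(Submodule.starProjection_apply_eq_zero_iff U).2 hx, sub_zero]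
    rw [← hx']
    refine map_mem_closure (f := fun y : E => y - U.starProjection y) hcont hdense
      fun y hy => ?_
    obtain ⟨u, hu, w, hw, rfl⟩ := Submodule.mem_sup.1 (iSup_eigenspaces_le hT t hy)
    have hwU : w ∈ Uᗮ := by
      have hO := orthogonalFamily_real_eigenspaces hT
      have : U ⟂ spectralSum T (Iic t) := by
        rw [hU, spectralSum, spectralSum, Submodule.isOrtho_iSup_left]
        intro i
        rw [Submodule.isOrtho_iSup_right]
        intro j
        exact hO.isOrtho (fun hij => not_lt.2 (mem_Iic.1 j.2) (hij ▸ mem_Ioi.1 i.2))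
      exact this.symm hw
    have e1 : U.starProjection u = u := Submodule.starProjection_eq_self_iff.2 hu
    have e2 : U.starProjection w = 0 := (Submodule.starProjection_apply_eq_zero_iff U).2 hwU
    simpa [map_add, e1, e2] using hw
  have hc : IsClosed {x : E | (inner ℂ (T x) x).re ≤ t * ‖x‖ ^ 2} :=
    isClosed_le (by fun_prop) (by fun_prop)
  exact closure_minimal (fun y hy => form_le_of_mem_spectralSum hT (fun μ hμ => hμ) hy) hc hW

/-- A linear family of vectors on which the form exceeds `t` has dimension at most that of the
spectral subspace. -/
theorem finrank_le_spectralSum [CompleteSpace E] (h : HasSmallTails T)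
    (hT : (T : E →ₗ[ℂ] E).IsSymmetric) {t : ℝ} (ht : 0 < t) {F : Type*} [AddCommGroup F]
    [Module ℂ F] [FiniteDimensional ℂ F] (L : F →ₗ[ℂ] E)
    (hL : ∀ f, f ≠ 0 → t * ‖L f‖ ^ 2 < (inner ℂ (T (L f)) (L f)).re) :
    Module.finrank ℂ F ≤ Module.finrank ℂ (spectralSum T (Ioi t)) := by
  have := h.finiteDimensional hT ht
  let Q : F →ₗ[ℂ] spectralSum T (Ioi t) :=
    ((spectralSum T (Ioi t)).orthogonalProjectionOnto : E →ₗ[ℂ] _).comp L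
  refine LinearMap.finrank_le_finrank_of_injective (f := Q) ?_
  rw [← LinearMap.ker_eq_bot, LinearMap.ker_eq_bot']
  intro f hf
  by_contra hne
  have hmem : L f ∈ (spectralSum T (Ioi t))ᗮ := by
    rw [← Submodule.orthogonalProjectionOnto_eq_zero_iff]
    exact hf
  exact absurd (form_le_of_mem_orthogonal h hT ht hmem) (not_le.2 (hL f hne))

end Spectral
end

/-! ### Enumeration of characteristic values with multiplicity. -/

noncomputable section

/-- Enumeration in increasing order of a locally finite multiset of positive numbers. -/
theorem exists_enumeration {m c : ℝ → ℕ} {s : ℝ → Finset ℝ}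
    (hs : ∀ R, 0 < R → ∀ t, t ∈ s R ↔ 0 < t ∧ t < R ∧ m t ≠ 0)
    (hc : ∀ R, 0 < R → c R = ∑ t ∈ s R, m t) (hunb : ∀ k, ∃ R, 0 < R ∧ k < c R) :
    ∃ L : ℕ → ℝ, Monotone L ∧ (∀ j, 0 < L j) ∧ (∀ j R, 0 < R → (L j < R ↔ j < c R)) ∧
      ∀ t, 0 < t → {j | L j = t}.encard = m t := by
  classical
  have hmono : ∀ R R', 0 < R → R ≤ R' → c R ≤ c R' := by
    intro R R' hR hRR
    rw [hc R hR, hc R' (hR.trans_le hRR)]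
    refine Finset.sum_le_sum_of_subset fun t ht => ?_
    rw [hs R hR] at ht
    rw [hs R' (hR.trans_le hRR)]
    exact ⟨ht.1, ht.2.1.trans_le hRR, ht.2.2⟩
  -- `c R` counts strictly below `R`, so the multiplicity of `t` enters only after `t`.
  have hstep : ∀ t R, 0 < t → t < R → c t + m t ≤ c R := by
    intro t R ht htR
    by_cases h0 : m t = 0
    · rw [h0, add_zero]; exact hmono t R ht htR.le
    have hn : t ∉ s t := fun h => lt_irrefl t ((hs t ht t).1 h).2.1
    rw [hc t ht, hc R (ht.trans htR), add_comm, ← Finset.sum_insert hn]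
    refine Finset.sum_le_sum_of_subset fun u hu => ?_
    rw [hs R (ht.trans htR)]
    rcases Finset.mem_insert.1 hu with rfl | hu
    · exact ⟨ht, htR, h0⟩
    · rw [hs t ht] at hu
      exact ⟨hu.1, hu.2.1.trans htR, hu.2.2⟩
  have hmax : ∀ R, 0 < R → 0 < c R → ∃ t ∈ s R, c R = c t + m t := by
    intro R hR hcR
    have hne : (s R).Nonempty := by
      rw [Finset.nonempty_iff_ne_empty]
      intro h
      rw [hc R hR, h, Finset.sum_empty] at hcR
      exact lt_irrefl _ hcR
    have hmem := (s R).max'_mem hne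
    set t := (s R).max' hne with htdef
    have ht := (hs R hR t).1 hmem
    have hn : t ∉ s t := fun h => lt_irrefl t ((hs t ht.1 t).1 h).2.1
    refine ⟨t, hmem, le_antisymm ?_ (hstep t R ht.1 ht.2.1)⟩
    rw [hc t ht.1, hc R hR, add_comm, ← Finset.sum_insert hn]
    refine Finset.sum_le_sum_of_subset fun u hu => ?_
    rcases eq_or_lt_of_le ((s R).le_max' u hu) with h | h
    · rw [h]; exact Finset.mem_insert_self _ _
    · refine Finset.mem_insert_of_mem ((hs t ht.1 u).2 ?_)
      have := (hs R hR u).1 hu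
      exact ⟨this.1, h, this.2.2⟩
  -- By local finiteness there is a gap immediately to the right of `t`.
  have hnext : ∀ t, 0 < t → ∃ R, t < R ∧ c R ≤ c t + m t := by
    intro t ht
    let g := (s (t + 1)).filter fun u => t < u
    have hR : ∃ R, t < R ∧ R ≤ t + 1 ∧ ∀ u ∈ s (t + 1), u < R → u ≤ t := by
      by_cases hg : g.Nonempty
      · refine ⟨g.min' hg, (Finset.mem_filter.1 (g.min'_mem hg)).2,
          ((hs _ (by linarith) _).1 (Finset.mem_filter.1 (g.min'_mem hg)).1).2.1.le, ?_⟩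
        intro u hu hlt
        by_contra hcon
        exact absurd (g.min'_le u (Finset.mem_filter.2 ⟨hu, not_le.1 hcon⟩)) (not_le.2 hlt)
      · refine ⟨t + 1, by linarith, le_rfl, fun u hu _ => ?_⟩
        by_contra hcon
        exact hg ⟨u, Finset.mem_filter.2 ⟨hu, not_le.1 hcon⟩⟩
    obtain ⟨R, htR, hR1, hR⟩ := hR
    have hR0 : 0 < R := ht.trans htR
    refine ⟨R, htR, ?_⟩
    have hn : t ∉ s t := fun h => lt_irrefl t ((hs t ht t).1 h).2.1
    rw [hc t ht, hc R hR0, add_comm, ← Finset.sum_insert hn]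
    refine Finset.sum_le_sum_of_subset fun u hu => ?_
    have hu' := (hs R hR0 u).1 hu
    have := hR u ((hs _ (by linarith) u).2 ⟨hu'.1, hu'.2.1.trans_le hR1, hu'.2.2⟩) hu'.2.1
    rcases eq_or_lt_of_le this with h | h
    · rw [h]; exact Finset.mem_insert_self _ _
    · exact Finset.mem_insert_of_mem ((hs t ht u).2 ⟨hu'.1, h, hu'.2.2⟩)
  have hex : ∀ j : ℕ, ∃ l, 0 < l ∧ ∀ R, 0 < R → (l < R ↔ j < c R) := by
    intro j
    obtain ⟨R0, hR0, hj⟩ := hunb j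
    -- The `j`-th value, counting from zero, is the least point at which the count including that
    -- point exceeds `j`.
    let A := (s R0).filter fun t => j < c t + m t
    have hA : A.Nonempty := by
      obtain ⟨t, ht, he⟩ := hmax R0 hR0 (by omega)
      exact ⟨t, Finset.mem_filter.2 ⟨ht, he ▸ hj⟩⟩
    have hl := Finset.mem_filter.1 (A.min'_mem hA)
    have hl1 := (hs R0 hR0 _).1 hl.1
    refine ⟨A.min' hA, hl1.1, fun R hR => ⟨fun h => hl.2.trans_le (hstep _ _ hl1.1 h), fun h => ?_⟩⟩
    by_contra hcon
    obtain ⟨t, ht, he⟩ := hmax R hR (by omega)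
    have ht' := (hs R hR t).1 ht
    have htA : t ∈ A := Finset.mem_filter.2 ⟨(hs R0 hR0 t).2
      ⟨ht'.1, ht'.2.1.trans ((not_lt.1 hcon).trans_lt hl1.2.1), ht'.2.2⟩, he ▸ h⟩
    exact absurd (ht'.2.1.trans_le (not_lt.1 hcon)) (not_lt.2 (A.min'_le t htA))
  choose L hL0 hL using hex
  refine ⟨L, fun i j hij => ?_, hL0, hL, fun t ht => ?_⟩
  · by_contra hcon
    have h1 := (hL j (L i) (hL0 i)).1 (not_le.1 hcon)
    exact lt_irrefl _ ((hL i (L i) (hL0 i)).2 (hij.trans_lt h1))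
  · have hset : {j | L j = t} = (Finset.Ico (c t) (c t + m t) : Finset ℕ) := by
      ext j
      simp only [mem_ofPred_eq, Finset.coe_Ico, mem_Ico]
      constructor
      · intro h
        constructor
        · by_contra hcon
          exact absurd ((hL j t ht).2 (not_le.1 hcon)) (not_lt.2 h.ge)
        · obtain ⟨R, htR, hR⟩ := hnext t ht
          exact ((hL j R (ht.trans htR)).1 (h.trans_lt htR)).trans_le hR
      · rintro ⟨h1, h2⟩
        refine le_antisymm ?_ ?_
        · by_contra hcon
          have := hstep t (L j) ht (not_le.1 hcon)
          exact lt_irrefl _ ((hL j _ (hL0 j)).2 (h2.trans_le this))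
        · by_contra hcon
          exact absurd ((hL j t ht).1 (not_le.1 hcon)) (not_lt.2 h1)
    rw [hset, Set.encard_coe_eq_coe_finsetCard, Nat.card_Ico]
    simp

section Spectral

variable {E : Type*} [NormedAddCommGroup E] [InnerProductSpace ℂ E] {T : E →L[ℂ] E}

theorem finrank_biSup_eigenspaces (hT : (T : E →ₗ[ℂ] E).IsSymmetric) (s : Finset ℝ)
    (hfd : ∀ μ ∈ s, FiniteDimensional ℂ (Module.End.eigenspace (T : Module.End ℂ E) (μ : ℂ))) :
    Module.finrank ℂ
      (⨆ μ ∈ s, Module.End.eigenspace (T : Module.End ℂ E) (μ : ℂ) : Submodule ℂ E) =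
      ∑ μ ∈ s, Module.finrank ℂ (Module.End.eigenspace (T : Module.End ℂ E) (μ : ℂ)) := by
  classical
  induction s using Finset.induction_on with
  | empty =>
    have h0 : (⨆ μ ∈ (∅ : Finset ℝ), Module.End.eigenspace (T : Module.End ℂ E) (μ : ℂ) :
        Submodule ℂ E) = ⊥ := by simp
    rw [h0, finrank_bot, Finset.sum_empty]
  | insert a s ha ih =>
    have h1 := hfd a (Finset.mem_insert_self _ _)
    have h2 : ∀ μ ∈ s, FiniteDimensional ℂ (Module.End.eigenspace (T : Module.End ℂ E) (μ : ℂ)) :=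
      fun μ hμ => hfd μ (Finset.mem_insert_of_mem hμ)
    have h3 : FiniteDimensional ℂ
        (⨆ μ ∈ s, Module.End.eigenspace (T : Module.End ℂ E) (μ : ℂ) : Submodule ℂ E) := by
      have : ∀ μ : s, FiniteDimensional ℂ
        (Module.End.eigenspace (T : Module.End ℂ E) ((μ : ℝ) : ℂ)) := fun μ => h2 μ μ.2
      rw [iSup_subtype']
      exact Submodule.finiteDimensional_iSup _
    have hdisj : Disjoint (Module.End.eigenspace (T : Module.End ℂ E) (a : ℂ))
        (⨆ μ ∈ s, Module.End.eigenspace (T : Module.End ℂ E) (μ : ℂ) : Submodule ℂ E) :=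
      (orthogonalFamily_real_eigenspaces hT).independent.disjoint_biSup (y := (s : Set ℝ))
        (by simpa using ha)
    rw [Finset.iSup_insert, Finset.sum_insert ha, ← ih h2,
      ← Submodule.finrank_sup_add_finrank_inf_eq, hdisj.eq_bot, finrank_bot, add_zero]

/-- The number, with multiplicity, of the characteristic values of `T` in `(0, R)`. -/
def charCount (T : E →L[ℂ] E) (R : ℝ) : ℕ := Module.finrank ℂ (spectralSum T (Ioi R⁻¹))

/-- The multiplicity of `t` as a characteristic value of `T`. -/
def charMult (T : E →L[ℂ] E) (t : ℝ) : ℕ :=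
  Module.finrank ℂ (Module.End.eigenspace (T : Module.End ℂ E) ((t⁻¹ : ℝ) : ℂ))

theorem eigenspace_le_spectralSum {S : Set ℝ} {μ : ℝ} (h : μ ∈ S) :
    Module.End.eigenspace (T : Module.End ℂ E) (μ : ℂ) ≤ spectralSum T S :=
  le_iSup (fun μ : S => Module.End.eigenspace (T : Module.End ℂ E) (((μ : ℝ)) : ℂ)) ⟨μ, h⟩

theorem HasSmallTails.finiteDimensional_eigenspace (h : HasSmallTails T)
    (hT : (T : E →ₗ[ℂ] E).IsSymmetric) {t : ℝ} (ht : 0 < t) :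
    FiniteDimensional ℂ (Module.End.eigenspace (T : Module.End ℂ E) (t : ℂ)) := by
  have := h.finiteDimensional hT (half_pos ht)
  exact Submodule.finiteDimensional_of_le
    (eigenspace_le_spectralSum (T := T) (S := Ioi (t / 2)) (mem_Ioi.2 (half_lt_self ht)))

/-- Distinct eigenvalues above `t` contribute independent eigenvectors to a finite-dimensional
spectral subspace. -/
theorem HasSmallTails.finite_eigenvalues (h : HasSmallTails T)
    (hT : (T : E →ₗ[ℂ] E).IsSymmetric) {t : ℝ} (ht : 0 < t) :
    {μ : ℝ | t < μ ∧ Module.End.eigenspace (T : Module.End ℂ E) (μ : ℂ) ≠ ⊥}.Finite := by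
  have hfd := h.finiteDimensional hT ht
  by_contra hinf
  obtain ⟨s, hs, hcard⟩ := Set.Infinite.exists_subset_card_eq hinf
    (Module.finrank ℂ (spectralSum T (Ioi t)) + 1)
  have hE : ∀ μ ∈ s, FiniteDimensional ℂ (Module.End.eigenspace (T : Module.End ℂ E) (μ : ℂ)) :=
    fun μ hμ => h.finiteDimensional_eigenspace hT (ht.trans (hs hμ).1)
  have h1 := finrank_biSup_eigenspaces hT s hE
  have h2 : (⨆ μ ∈ s, Module.End.eigenspace (T : Module.End ℂ E) (μ : ℂ) : Submodule ℂ E) ≤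
      spectralSum T (Ioi t) :=
    iSup₂_le fun μ hμ => eigenspace_le_spectralSum (hs hμ).1
  have h3 := Submodule.finrank_mono h2
  have h4 : s.card ≤
      ∑ μ ∈ s, Module.finrank ℂ (Module.End.eigenspace (T : Module.End ℂ E) (μ : ℂ)) := by
    rw [Finset.card_eq_sum_ones]
    refine Finset.sum_le_sum fun μ hμ => ?_
    have := hE μ hμ
    exact Submodule.one_le_finrank_iff.2 (hs hμ).2
  omega

/-- Enumeration of the positive characteristic values of an operator with small tails. -/
theorem exists_charValues (h : HasSmallTails T) (hT : (T : E →ₗ[ℂ] E).IsSymmetric)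
    (hunb : ∀ k, ∃ R, 0 < R ∧ k < charCount T R) :
    ∃ L : ℕ → ℝ, Monotone L ∧ (∀ j, 0 < L j) ∧ (∀ j R, 0 < R → (L j < R ↔ j < charCount T R)) ∧
      ∀ t, 0 < t → {j | L j = t}.encard = charMult T t := by
  classical
  have hfin : ∀ R : ℝ, 0 < R → {t : ℝ | 0 < t ∧ t < R ∧ charMult T t ≠ 0}.Finite := by
    intro R hR
    refine ((h.finite_eigenvalues hT (inv_pos.2 hR)).image (·⁻¹)).subset ?_
    rintro t ⟨h1, h2, h3⟩
    refine ⟨t⁻¹, ⟨inv_strictAnti₀ h1 h2, fun h0 => h3 ?_⟩, inv_inv t⟩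
    rw [charMult, h0, finrank_bot]
  refine exists_enumeration (m := charMult T) (c := charCount T)
    (s := fun R => if hR : 0 < R then (hfin R hR).toFinset else ∅) ?_ ?_ hunb
  · intro R hR t
    simp [hR]
  · intro R hR
    simp only [hR, dif_pos]
    have hE : ∀ μ ∈ (hfin R hR).toFinset.map ⟨(·⁻¹), inv_injective⟩,
        FiniteDimensional ℂ (Module.End.eigenspace (T : Module.End ℂ E) (μ : ℂ)) := by
      intro μ hμ
      obtain ⟨t, ht, rfl⟩ := Finset.mem_map.1 hμ
      exact h.finiteDimensional_eigenspace hT (inv_pos.2 ((hfin R hR).mem_toFinset.1 ht).1)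
    have h1 := finrank_biSup_eigenspaces hT _ hE
    rw [Finset.sum_map] at h1
    refine Eq.trans ?_ h1
    unfold charCount
    suffices hsup : spectralSum T (Ioi R⁻¹) =
        ⨆ μ ∈ (hfin R hR).toFinset.map ⟨(·⁻¹), inv_injective⟩,
          Module.End.eigenspace (T : Module.End ℂ E) (μ : ℂ) by rw [hsup]
    refine le_antisymm (iSup_le fun μ => ?_) (iSup₂_le fun μ hμ => ?_)
    · by_cases h0 : Module.End.eigenspace (T : Module.End ℂ E) (((μ : ℝ)) : ℂ) = ⊥
      · rw [h0]; exact bot_le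
      have hμ0 : (0 : ℝ) < μ := (inv_pos.2 hR).trans μ.2
      have := h.finiteDimensional_eigenspace hT hμ0
      refine le_iSup₂_of_le (μ : ℝ) ?_ le_rfl
      refine Finset.mem_map.2 ⟨(μ : ℝ)⁻¹, (hfin R hR).mem_toFinset.2 ⟨inv_pos.2 hμ0, ?_, ?_⟩,
        inv_inv _⟩
      · exact (inv_lt_comm₀ hR hμ0).1 μ.2
      · rw [charMult, inv_inv]
        exact fun hh => h0 (Submodule.finrank_eq_zero.1 hh)
    · obtain ⟨t, ht, rfl⟩ := Finset.mem_map.1 hμ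
      have := (hfin R hR).mem_toFinset.1 ht
      exact eigenspace_le_spectralSum (mem_Ioi.2 (inv_strictAnti₀ this.1 this.2.1))

end Spectral
end

/-! ### From an abstract self-similarity to asymptotics of characteristic values. -/

noncomputable section

/-- Asymptotics of two interlaced sequences that grow geometrically up to bounded errors. -/
theorem exists_tendsto_of_interlaced {Lp Lm : ℕ → ℝ} {q C c : ℝ} {Zp Zm M n : ℕ} (hq0 : 0 < q)
    (hq1 : q < 1) (hC : 0 ≤ C) (hc : 0 < c) (hZ : Zp + Zm = M) (hM : 1 ≤ M)
    (h1 : ∀ j, Lm (j + Zm) ≤ Lp j / q + C) (h2 : ∀ j, Lp (j + Zp) ≤ Lm j / q + C)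
    (hlow : ∀ k j, k * M + n ≤ j → c * (q ^ (2 * k))⁻¹ ≤ Lp j) (l : ℕ) :
    ∃ τ : ℝ, 0 < τ ∧ Tendsto (fun k => Lp (l + k * M) * q ^ (2 * k)) atTop (𝓝 τ) ∧
      Tendsto (fun k => Lm (l + Zm + k * M) * q ^ (2 * k + 1)) atTop (𝓝 τ) := by
  set x : ℕ → ℝ := fun k => Lp (l + k * M) * q ^ (2 * k) with hx
  set y : ℕ → ℝ := fun k => Lm (l + Zm + k * M) * q ^ (2 * k + 1) with hy
  have hyx : ∀ k, y k ≤ x k + C * q ^ (2 * k + 1) := by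
    intro k
    have h := h1 (l + k * M)
    rw [show l + k * M + Zm = l + Zm + k * M by ring] at h
    calc y k ≤ (Lp (l + k * M) / q + C) * q ^ (2 * k + 1) := by
          simp only [hy]; gcongr
      _ = x k + C * q ^ (2 * k + 1) := by
          simp only [hx, pow_succ]; field_simp
  have hxy : ∀ k, x (k + 1) ≤ y k + C * q ^ (2 * k + 2) := by
    intro k
    have h := h2 (l + Zm + k * M)
    rw [show l + Zm + k * M + Zp = l + (k + 1) * M by rw [← hZ]; ring] at h
    calc x (k + 1) ≤ (Lm (l + Zm + k * M) / q + C) * q ^ (2 * (k + 1)) := by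
          simp only [hx]; gcongr
      _ = y k + C * q ^ (2 * k + 2) := by
          simp only [hy]; field_simp; ring
  have hq2 : q ^ 2 < 1 := pow_lt_one₀ hq0.le hq1 two_ne_zero
  -- `D` solves `D = D q² + C q + C q²`: the correction `D q^(2k)` absorbs the errors of both
  -- half-steps, which makes `z` antitone.
  set D : ℝ := C * (q + q ^ 2) / (1 - q ^ 2) with hD
  have hD' : D * (1 - q ^ 2) = C * (q + q ^ 2) := div_mul_cancel₀ _ (by linarith)
  have hD0 : 0 ≤ D := div_nonneg (by positivity) (by linarith)
  set z : ℕ → ℝ := fun k => x k + D * q ^ (2 * k) with hz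
  have hanti : Antitone z := by
    refine antitone_nat_of_succ_le fun k => ?_
    have e1 := hyx k
    have e2 := hxy k
    have e3 : D * q ^ (2 * k) = D * q ^ (2 * (k + 1)) + C * q ^ (2 * k + 1) +
        C * q ^ (2 * k + 2) := by
      have : q ^ (2 * k) * (D * (1 - q ^ 2)) = q ^ (2 * k) * (C * (q + q ^ 2)) := by rw [hD']
      ring_nf at this ⊢
      linarith
    simp only [hz]
    linarith
  -- Going back `n` periods absorbs the offset `n` in `hlow`, since `n ≤ n * M`; the price is the
  -- factor `q ^ (2 * n)`.
  have hxlow : ∀ k, n ≤ k → c * q ^ (2 * n) ≤ x k := by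
    intro k hk
    have h := hlow (k - n) (l + k * M) (by
      obtain ⟨r, rfl⟩ := Nat.exists_eq_add_of_le hk
      rw [Nat.add_sub_cancel_left, add_mul]
      have : n ≤ n * M := Nat.le_mul_of_pos_right n hM
      omega)
    calc c * q ^ (2 * n) = c * (q ^ (2 * (k - n)))⁻¹ * q ^ (2 * k) := by
          rw [show 2 * k = 2 * (k - n) + 2 * n by omega, pow_add]
          field_simp
      _ ≤ x k := by simp only [hx]; gcongr
  have hzlow : ∀ k, c * q ^ (2 * n) ≤ z k := by
    intro k
    rcases le_total n k with h | h
    · have := hxlow k h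
      have : 0 ≤ D * q ^ (2 * k) := by positivity
      simp only [hz]; linarith
    · refine le_trans ?_ (hanti h)
      have := hxlow n le_rfl
      have : 0 ≤ D * q ^ (2 * n) := by positivity
      simp only [hz]; linarith
  have hzt : Tendsto z atTop (𝓝 (⨅ k, z k)) :=
    tendsto_atTop_ciInf hanti ⟨_, by rintro _ ⟨k, rfl⟩; exact hzlow k⟩
  have hpow : Tendsto (fun k : ℕ => q ^ (2 * k)) atTop (𝓝 0) := by
    simp only [pow_mul]
    exact tendsto_pow_atTop_nhds_zero_of_lt_one (by positivity) hq2
  have hxt : Tendsto x atTop (𝓝 (⨅ k, z k)) := by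
    have := hzt.sub (hpow.const_mul D)
    simpa [hz] using this
  refine ⟨⨅ k, z k, lt_of_lt_of_le (by positivity) (le_ciInf hzlow), hxt, ?_⟩
  -- `y k` is squeezed between `x (k + 1)` and `x k`, up to vanishing errors.
  refine tendsto_of_tendsto_of_tendsto_of_le_of_le (g := fun k => x (k + 1) - C * q ^ 2 * q ^ (2 * k))
    (h := fun k => x k + C * q * q ^ (2 * k)) ?_ ?_ (fun k => ?_) (fun k => ?_)
  · simpa using ((tendsto_add_atTop_iff_nat 1).2 hxt).sub (hpow.const_mul (C * q ^ 2))
  · simpa using hxt.add (hpow.const_mul (C * q))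
  · have := hxy k
    rw [pow_add] at this
    change _ ≤ y k
    linarith
  · have := hyx k
    rw [pow_add, pow_one] at this
    change y k ≤ _
    linarith

/-- The free weight `δ` allows the constant at the first term to be as close to one as needed. -/
theorem norm_add_sq_le_weighted {E : Type*} [SeminormedAddCommGroup E] (x y : E) {δ : ℝ} (hδ : 0 < δ) :
    ‖x + y‖ ^ 2 ≤ (1 + δ) * ‖x‖ ^ 2 + (1 + δ⁻¹) * ‖y‖ ^ 2 := by
  have h1 : ‖x + y‖ ^ 2 ≤ (‖x‖ + ‖y‖) ^ 2 := by gcongr; exact norm_add_le x y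
  have h2 : 2 * ‖x‖ * ‖y‖ ≤ δ * ‖x‖ ^ 2 + δ⁻¹ * ‖y‖ ^ 2 := by
    have h : 0 ≤ δ⁻¹ * (δ * ‖x‖ - ‖y‖) ^ 2 := by positivity
    have : δ⁻¹ * (δ * ‖x‖ - ‖y‖) ^ 2 = δ * ‖x‖ ^ 2 + δ⁻¹ * ‖y‖ ^ 2 - 2 * ‖x‖ * ‖y‖ := by
      field_simp; ring
    linarith
  nlinarith

section Spectral

variable {E : Type*} [NormedAddCommGroup E] [InnerProductSpace ℂ E] {T : E →L[ℂ] E}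

theorem isSymmetric_neg (hT : (T : E →ₗ[ℂ] E).IsSymmetric) :
    ((-T : E →L[ℂ] E) : E →ₗ[ℂ] E).IsSymmetric := fun x y => by
  simpa using hT x y

/-- A similarity that reverses the sign of the form, together with finitely many vectors that
diagonalize it, transfers characteristic values of `T` to those of `-T`. -/
theorem exists_charCount_le [CompleteSpace E] (h : HasSmallTails T)
    (hT : (T : E →ₗ[ℂ] E).IsSymmetric) {ι : Type*} [Fintype ι] (V : E →ₗ[ℂ] E)
    (Φ : (ι → ℂ) →ₗ[ℂ] E) (ζ : ι → ℝ) {s d : ℝ} (hs : 0 < s) (hd : d < 0)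
    (hV : ∀ w, ‖V w‖ ^ 2 = s * ‖w‖ ^ 2)
    (hform : ∀ w c, (inner ℂ (T (V w + Φ c)) (V w + Φ c)).re =
      d * (inner ℂ (T w) w).re + ∑ k, ζ k * ‖c k‖ ^ 2) :
    ∃ C : ℝ, 0 < C ∧ ∀ R, C < R →
      charCount T (-d / s * (R - C)) + Nat.card {k // ζ k < 0} ≤ charCount (-T) R := by
  classical
  obtain ⟨c0, hc0, hζ⟩ : ∃ c0 : ℝ, 0 < c0 ∧ ∀ k, ζ k < 0 → c0 ≤ -ζ k := by
    -- `c0` bounds the finitely many `|ζ k|` with `ζ k < 0` from below; the value `1` at the other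
    -- indices is a harmless filler.
    obtain ⟨ε, hε, hh⟩ := Pi.exists_forall_pos_add_lt (x := fun k : ι => (0 : ℝ))
      (y := fun k => if ζ k < 0 then -ζ k else 1) (fun k => by
        split_ifs <;> linarith)
    exact ⟨ε, hε, fun k hk => by have := hh k; rw [if_pos hk, zero_add] at this; exact this.le⟩
  set A : ℝ := ‖LinearMap.toContinuousLinearMap Φ‖ ^ 2 with hA
  have hΦ : ∀ c, ‖Φ c‖ ^ 2 ≤ A * ∑ k, ‖c k‖ ^ 2 := by
    intro c
    have e1 : ‖Φ c‖ ≤ ‖LinearMap.toContinuousLinearMap Φ‖ * ‖c‖ :=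
      (LinearMap.toContinuousLinearMap Φ).le_opNorm c
    have e2 : ‖c‖ ^ 2 ≤ ∑ k, ‖c k‖ ^ 2 := by
      have hsq : 0 ≤ ∑ k, ‖c k‖ ^ 2 := Finset.sum_nonneg fun k _ => by positivity
      have : ‖c‖ ≤ Real.sqrt (∑ k, ‖c k‖ ^ 2) :=
        (pi_norm_le_iff_of_nonneg (Real.sqrt_nonneg _)).2 fun k => Real.le_sqrt_of_sq_le
          (Finset.single_le_sum (f := fun k => ‖c k‖ ^ 2) (fun k _ => by positivity)
            (Finset.mem_univ k))
      calc ‖c‖ ^ 2 ≤ Real.sqrt (∑ k, ‖c k‖ ^ 2) ^ 2 := by gcongr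
        _ = _ := Real.sq_sqrt hsq
    calc ‖Φ c‖ ^ 2 ≤ (‖LinearMap.toContinuousLinearMap Φ‖ * ‖c‖) ^ 2 := by gcongr
      _ = A * ‖c‖ ^ 2 := by rw [hA]; ring
      _ ≤ _ := by gcongr
  have hA0 : 0 ≤ A := by positivity
  -- This `C` satisfies `A / C < c0`, so the form on the added vectors beats the norm term they
  -- produce.
  refine ⟨A / c0 + 1, by positivity, fun R hR => ?_⟩
  set C := A / c0 + 1 with hC
  have hC0 : 0 < C := by positivity
  have hR0 : 0 < R := hC0.trans hR
  have hRC : 0 < R - C := by linarith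
  set S := -d / s * (R - C) with hS
  have hS0 : 0 < S := mul_pos (div_pos (by linarith) hs) hRC
  have hAC : A < c0 * C := by
    have : c0 * C = A + c0 := by rw [hC]; field_simp
    linarith
  have := h.finiteDimensional hT (inv_pos.2 hS0)
  let ext : ({k // ζ k < 0} → ℂ) →ₗ[ℂ] (ι → ℂ) :=
    Function.ExtendByZero.linearMap ℂ (Subtype.val : {k // ζ k < 0} → ι)
  have hext1 : ∀ c k (hk : ζ k < 0), ext c k = c ⟨k, hk⟩ := fun c k hk =>
    Subtype.val_injective.extend_apply c 0 ⟨k, hk⟩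
  have hext0 : ∀ c k, ¬ ζ k < 0 → ext c k = 0 := fun c k hk =>
    Function.extend_apply' (f := (Subtype.val : {k // ζ k < 0} → ι)) c 0 k (by rintro ⟨a, rfl⟩; exact hk a.2)
  let L : (spectralSum T (Ioi S⁻¹)) × ({k // ζ k < 0} → ℂ) →ₗ[ℂ] E :=
    (V.comp (spectralSum T (Ioi S⁻¹)).subtype).coprod (Φ.comp ext)
  have key := finrank_le_spectralSum h.neg (isSymmetric_neg hT) (inv_pos.2 hR0) L ?_
  · rw [Module.finrank_prod, Module.finrank_fintype_fun_eq_card, ← Nat.card_eq_fintype_card] at key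
    exact key
  rintro ⟨⟨w, hw⟩, c⟩ hne
  have hL : L (⟨w, hw⟩, c) = V w + Φ (ext c) := by simp [L]
  rw [hL]
  have e1 : (inner ℂ ((-T) (V w + Φ (ext c))) (V w + Φ (ext c))).re =
      -d * (inner ℂ (T w) w).re + ∑ k, -ζ k * ‖ext c k‖ ^ 2 := by
    have := hform w (ext c)
    rw [neg_apply, inner_neg_left, Complex.neg_re, this]
    simp only [neg_mul, Finset.sum_neg_distrib]
    ring
  rw [e1]
  -- Now `1 + δ = R / (R - C)` and `1 + δ⁻¹ = R / C`. At threshold `R⁻¹` the `V` part balances the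
  -- level `S⁻¹` exactly and the `Φ` part gets the coefficient `A / C`.
  set δ := C / (R - C) with hδ
  have hδ0 : 0 < δ := div_pos hC0 hRC
  have e2 := norm_add_sq_le_weighted (V w) (Φ (ext c)) hδ0
  rw [hV] at e2
  set X := ∑ k, ‖ext c k‖ ^ 2 with hX
  have hX0 : 0 ≤ X := Finset.sum_nonneg fun k _ => by positivity
  have e3 : c0 * X ≤ ∑ k, -ζ k * ‖ext c k‖ ^ 2 := by
    rw [hX, Finset.mul_sum]
    refine Finset.sum_le_sum fun k _ => ?_
    by_cases hk : ζ k < 0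
    · have := hζ k hk
      gcongr
    · rw [hext0 c k hk]; simp
  have e4 : R⁻¹ * ((1 + δ) * (s * ‖w‖ ^ 2)) = -d * (S⁻¹ * ‖w‖ ^ 2) := by
    have hd0 : d ≠ 0 := hd.ne
    rw [hδ, hS]
    field_simp
    ring
  have e5 : R⁻¹ * ((1 + δ⁻¹) * (A * X)) = A / C * X := by
    rw [hδ]
    field_simp
    ring
  have e6 : R⁻¹ * ‖V w + Φ (ext c)‖ ^ 2 ≤ -d * (S⁻¹ * ‖w‖ ^ 2) + A / C * X := by
    rw [← e4, ← e5, ← mul_add]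
    have := hΦ (ext c)
    gcongr
    refine e2.trans ?_
    gcongr
  have hAC' : A / C < c0 := by rwa [div_lt_iff₀ hC0]
  refine lt_of_le_of_lt e6 ?_
  -- Strictness comes from the spectral subspace if `w ≠ 0`, and from `A / C < c0` if only `c` is
  -- non-zero.
  by_cases hw0 : w = 0
  · have hc : c ≠ 0 := by
      rintro rfl
      exact hne (by simp [hw0])
    have hXpos : 0 < X := by
      obtain ⟨k, hk⟩ := Function.ne_iff.1 hc
      have h1 : 0 < ‖ext c k‖ ^ 2 := by
        rw [hext1 c k k.2]
        have : c k ≠ 0 := hk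
        positivity
      exact h1.trans_le (Finset.single_le_sum (f := fun k => ‖ext c k‖ ^ 2)
        (fun k _ => by positivity) (Finset.mem_univ (k : ι)))
    have : A / C * X < c0 * X := by gcongr
    simp only [hw0, norm_zero, map_zero, inner_zero_left, Complex.zero_re]
    linarith
  · have h1 := le_form_of_mem_spectralSum hT (fun μ hμ => hμ) hw hw0
    have h2 : -d * (S⁻¹ * ‖w‖ ^ 2) < -d * (inner ℂ (T w) w).re :=
      mul_lt_mul_of_pos_left h1 (by linarith)
    have : A / C * X ≤ c0 * X := by gcongr
    linarith

/-- Characteristic values of `T` and `-T` are asymptotically periodic on the logarithmic scale. -/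
theorem exists_charValues_asymptotics [CompleteSpace E] (h : HasSmallTails T)
    (hT : (T : E →ₗ[ℂ] E).IsSymmetric) {ι : Type*} [Fintype ι] (V : E →ₗ[ℂ] E)
    (Φ : (ι → ℂ) →ₗ[ℂ] E) (ζ : ι → ℝ) {s d q : ℝ} (hs : 0 < s) (hd : d < 0) (hq : -d / s = q)
    (hq1 : q < 1) (hV : ∀ w, ‖V w‖ ^ 2 = s * ‖w‖ ^ 2)
    (hform : ∀ w c, (inner ℂ (T (V w + Φ c)) (V w + Φ c)).re =
      d * (inner ℂ (T w) w).re + ∑ k, ζ k * ‖c k‖ ^ 2)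
    {Zp Zm M n : ℕ} (hZp : Nat.card {k // 0 < ζ k} = Zp) (hZm : Nat.card {k // ζ k < 0} = Zm)
    (hM : Zp + Zm = M) (hM1 : 1 ≤ M) {B : ℝ} (hB : 0 < B)
    (hup : ∀ k : ℕ, ∃ (J : Type) (_ : Fintype J) (A : E →ₗ[ℂ] (J → ℂ)),
      Fintype.card J ≤ k * M + n ∧ ∀ x ∈ LinearMap.ker A,
        (inner ℂ (T x) x).re ≤ B * q ^ (2 * k) * ‖x‖ ^ 2) :
    ∃ Lp Lm : ℕ → ℝ, (Monotone Lp ∧ (∀ j, 0 < Lp j) ∧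
        ∀ t, 0 < t → {j | Lp j = t}.encard = charMult T t) ∧
      (Monotone Lm ∧ (∀ j, 0 < Lm j) ∧
        ∀ t, 0 < t → {j | Lm j = t}.encard = charMult (-T) t) ∧
      ∀ l : ℕ, ∃ τ : ℝ, 0 < τ ∧ Tendsto (fun k => Lp (l + k * M) * q ^ (2 * k)) atTop (𝓝 τ) ∧
        Tendsto (fun k => Lm (l + Zm + k * M) * q ^ (2 * k + 1)) atTop (𝓝 τ) := by
  have hq0 : 0 < q := hq ▸ div_pos (by linarith) hs
  obtain ⟨C1, hC1, h1⟩ := exists_charCount_le h hT V Φ ζ hs hd hV hform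
  -- `-T` satisfies the same identity with all `ζ k` negated, so the two signs exchange roles.
  obtain ⟨C2, hC2, h2⟩ := exists_charCount_le h.neg (isSymmetric_neg hT) V Φ (fun k => -ζ k) hs hd
    hV (fun w c => by
      have := hform w c
      simp only [neg_apply, inner_neg_left, Complex.neg_re, this, neg_mul,
        Finset.sum_neg_distrib]
      ring)
  simp only [neg_neg, neg_lt_zero, hq, hZp, hZm] at h1 h2
  have h1' : ∀ R, 0 < R → charCount T R + Zm ≤ charCount (-T) (R / q + C1) := fun R hR => by
    have := h1 (R / q + C1) (by have := div_pos hR hq0; linarith)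
    rwa [add_sub_cancel_right, mul_div_cancel₀ _ hq0.ne'] at this
  have h2' : ∀ R, 0 < R → charCount (-T) R + Zp ≤ charCount T (R / q + C2) := fun R hR => by
    have := h2 (R / q + C2) (by have := div_pos hR hq0; linarith)
    rwa [add_sub_cancel_right, mul_div_cancel₀ _ hq0.ne'] at this
  -- Each passage from `T` to `-T` and back adds `Zm + Zp = M ≥ 1` to the count.
  have hunb : ∀ k : ℕ, ∃ R, 0 < R ∧ k ≤ charCount T R := by
    intro k
    induction k with
    | zero => exact ⟨1, one_pos, Nat.zero_le _⟩
    | succ k ih =>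
      obtain ⟨R, hR, hk⟩ := ih
      have hR1 : 0 < R / q + C1 := by positivity
      have e1 := h1' R hR
      have e2 := h2' _ hR1
      exact ⟨(R / q + C1) / q + C2, by positivity, by omega⟩
  obtain ⟨Lp, hpm, hp0, hpc, hpe⟩ := exists_charValues h hT fun k => by
    obtain ⟨R, hR, hk⟩ := hunb (k + 1)
    exact ⟨R, hR, hk⟩
  obtain ⟨Lm, hmm, hm0, hmc, hme⟩ := exists_charValues h.neg (isSymmetric_neg hT) fun k => by
    obtain ⟨R, hR, hk⟩ := hunb (k + 1)
    exact ⟨R / q + C1, by positivity, by have := h1' R hR; omega⟩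
  refine ⟨Lp, Lm, ⟨hpm, hp0, hpe⟩, ⟨hmm, hm0, hme⟩, exists_tendsto_of_interlaced hq0 hq1
    (C := C1 + C2) (c := B⁻¹) (Zp := Zp) (n := n) (by positivity) (by positivity) hM hM1 ?_ ?_ ?_⟩
  · intro j
    -- Otherwise the counting inequality at `R = Lm (j + Zm)` would put more than `j + Zm`
    -- characteristic values of `-T` strictly below `Lm (j + Zm)`.
    by_contra hcon
    have hlt : Lp j < q * (Lm (j + Zm) - C1) := by
      have := (div_lt_iff₀' hq0).1 (by linarith : Lp j / q < Lm (j + Zm) - C1)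
      exact this
    have e1 := (hpc j _ ((hp0 j).trans hlt)).1 hlt
    have e2 := h1 (Lm (j + Zm)) (by have := div_pos (hp0 j) hq0; linarith)
    exact lt_irrefl _ ((hmc (j + Zm) _ (hm0 _)).2 (by omega))
  · intro j
    by_contra hcon
    have hlt : Lm j < q * (Lp (j + Zp) - C2) := by
      have := (div_lt_iff₀' hq0).1 (by linarith : Lm j / q < Lp (j + Zp) - C2)
      exact this
    have e1 := (hmc j _ ((hm0 j).trans hlt)).1 hlt
    have e2 := h2 (Lp (j + Zp)) (by have := div_pos (hm0 j) hq0; linarith)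
    exact lt_irrefl _ ((hpc (j + Zp) _ (hp0 _)).2 (by omega))
  · intro k j hkj
    obtain ⟨J, hJ, A, hcard, hA⟩ := hup k
    have e1 := (finrank_spectralSum_le hT A hA).2
    rw [Module.finrank_fintype_fun_eq_card] at e1
    have hpos : 0 < (B * q ^ (2 * k))⁻¹ := by positivity
    rw [← mul_inv]
    by_contra hcon
    have e2 := (hpc j _ hpos).1 (not_le.1 hcon)
    rw [charCount, inv_inv] at e2
    omega

end Spectral
end

/-! ### The energy space described by `n`-th derivatives. -/

noncomputable section

/-- Extension by zero of a function on `[0, 1]`. -/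
def zeroExt (g : Lp ℂ 2 unitMeasure) : ℝ → ℂ := (Icc (0 : ℝ) 1).indicator g

/-- The `(k + 1)`-fold primitive, vanishing at the origin, of a square integrable function. -/
def iterPrim (g : Lp ℂ 2 unitMeasure) : ℕ → ℝ → ℂ
  | 0 => fun x => ∫ t in (0 : ℝ)..x, zeroExt g t
  | k + 1 => fun x => ∫ t in (0 : ℝ)..x, iterPrim g k t

theorem stronglyMeasurable_zeroExt (g : Lp ℂ 2 unitMeasure) : StronglyMeasurable (zeroExt g) :=
  (Lp.stronglyMeasurable g).indicator measurableSet_Icc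

theorem memLp_zeroExt (g : Lp ℂ 2 unitMeasure) : MemLp (zeroExt g) 2 volume :=
  (memLp_indicator_iff_restrict measurableSet_Icc).2 (Lp.memLp g)

theorem integrable_zeroExt (g : Lp ℂ 2 unitMeasure) : Integrable (zeroExt g) :=
  (integrable_indicator_iff measurableSet_Icc).2 ((Lp.memLp g).integrable (by norm_num))

theorem zeroExt_of_notMem (g : Lp ℂ 2 unitMeasure) {x : ℝ} (hx : x ∉ Icc (0 : ℝ) 1) :
    zeroExt g x = 0 := indicator_of_notMem hx _

theorem zeroExt_ae (g : Lp ℂ 2 unitMeasure) : zeroExt g =ᵐ[unitMeasure] g :=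
  indicator_ae_eq_restrict measurableSet_Icc

theorem norm_sq_eq_integral (g : Lp ℂ 2 unitMeasure) :
    ‖g‖ ^ 2 = ∫ x in Icc (0 : ℝ) 1, ‖g x‖ ^ 2 := by
  have h := L2.inner_def (𝕜 := ℂ) g g
  rw [inner_self_eq_norm_sq_to_K] at h
  have h2 : ∀ x, inner ℂ (g x) (g x) = ((‖g x‖ ^ 2 : ℝ) : ℂ) := fun x => by
    rw [inner_self_eq_norm_sq_to_K]; simp
  simp only [h2] at h
  have h3 := h.trans (integral_ofReal (𝕜 := ℂ) (f := fun x => ‖g x‖ ^ 2))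
  exact_mod_cast h3

theorem norm_sq_eq_integral_zeroExt (g : Lp ℂ 2 unitMeasure) :
    ‖g‖ ^ 2 = ∫ x, ‖zeroExt g x‖ ^ 2 := by
  rw [norm_sq_eq_integral, ← integral_indicator measurableSet_Icc]
  congr 1
  ext x
  by_cases hx : x ∈ Icc (0 : ℝ) 1
  · simp [zeroExt, hx]
  · simp [zeroExt, hx]

theorem continuous_iterPrim (g : Lp ℂ 2 unitMeasure) (k : ℕ) : Continuous (iterPrim g k) := by
  induction k with
  | zero =>
    exact intervalIntegral.continuous_primitive (μ := volume)
      (fun a b => (integrable_zeroExt g).intervalIntegrable) 0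
  | succ k ih =>
    exact intervalIntegral.continuous_primitive (μ := volume)
      (fun a b => ih.intervalIntegrable a b) 0

theorem hasDerivAt_iterPrim_succ (g : Lp ℂ 2 unitMeasure) (k : ℕ) (x : ℝ) :
    HasDerivAt (iterPrim g (k + 1)) (iterPrim g k x) x :=
  intervalIntegral.integral_hasDerivAt_right ((continuous_iterPrim g k).intervalIntegrable _ _)
    (continuous_iterPrim g k).stronglyMeasurable.stronglyMeasurableAtFilter
    (continuous_iterPrim g k).continuousAt

theorem deriv_iterPrim_succ (g : Lp ℂ 2 unitMeasure) (k : ℕ) :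
    deriv (iterPrim g (k + 1)) = iterPrim g k :=
  funext fun x => (hasDerivAt_iterPrim_succ g k x).deriv

theorem contDiff_iterPrim (g : Lp ℂ 2 unitMeasure) (k : ℕ) : ContDiff ℝ k (iterPrim g k) := by
  induction k with
  | zero => exact contDiff_zero.2 (continuous_iterPrim g 0)
  | succ k ih =>
    rw [Nat.cast_add, Nat.cast_one, contDiff_succ_iff_deriv]
    refine ⟨fun x => (hasDerivAt_iterPrim_succ g k x).differentiableAt, by simp, ?_⟩
    rwa [deriv_iterPrim_succ]

theorem iteratedDeriv_iterPrim (g : Lp ℂ 2 unitMeasure) (j k : ℕ) :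
    iteratedDeriv j (iterPrim g (k + j)) = iterPrim g k := by
  induction j with
  | zero => simp
  | succ j ih => rw [iteratedDeriv_succ', ← add_assoc, deriv_iterPrim_succ, ih]

theorem iterPrim_add (g h : Lp ℂ 2 unitMeasure) (k : ℕ) :
    iterPrim (g + h) k = iterPrim g k + iterPrim h k := by
  induction k with
  | zero =>
    ext x
    have hae : zeroExt (g + h) =ᵐ[volume] zeroExt g + zeroExt h := by
      have := Lp.coeFn_add g h
      rw [Filter.EventuallyEq, ae_restrict_iff' measurableSet_Icc] at this
      filter_upwards [this] with x hx
      by_cases hm : x ∈ Icc (0 : ℝ) 1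
      · simp only [zeroExt, hm, indicator_of_mem, hx hm, Pi.add_apply]
      · simp [zeroExt, hm]
    simp only [iterPrim, Pi.add_apply]
    rw [← intervalIntegral.integral_add (integrable_zeroExt g).intervalIntegrable
      (integrable_zeroExt h).intervalIntegrable]
    exact intervalIntegral.integral_congr_ae (hae.mono fun x hx _ => hx)
  | succ k ih =>
    ext x
    simp only [iterPrim, Pi.add_apply, ih]
    exact intervalIntegral.integral_add ((continuous_iterPrim g k).intervalIntegrable _ _)
      ((continuous_iterPrim h k).intervalIntegrable _ _)

theorem iterPrim_smul (c : ℂ) (g : Lp ℂ 2 unitMeasure) (k : ℕ) :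
    iterPrim (c • g) k = c • iterPrim g k := by
  induction k with
  | zero =>
    ext x
    have hae : zeroExt (c • g) =ᵐ[volume] c • zeroExt g := by
      have := Lp.coeFn_smul c g
      rw [Filter.EventuallyEq, ae_restrict_iff' measurableSet_Icc] at this
      filter_upwards [this] with x hx
      by_cases hm : x ∈ Icc (0 : ℝ) 1
      · simp only [zeroExt, hm, indicator_of_mem, hx hm, Pi.smul_apply]
      · simp [zeroExt, hm]
    simp only [iterPrim, Pi.smul_apply]
    rw [← intervalIntegral.integral_smul]
    exact intervalIntegral.integral_congr_ae (hae.mono fun x hx _ => hx)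
  | succ k ih =>
    ext x
    simp only [iterPrim, Pi.smul_apply, ih]
    exact intervalIntegral.integral_smul _ _

/-- Evaluation of an iterated primitive, as a linear functional. -/
def iterPrimEval (k : ℕ) (x : ℝ) : Lp ℂ 2 unitMeasure →ₗ[ℂ] ℂ where
  toFun g := iterPrim g k x
  map_add' g h := by rw [iterPrim_add]; rfl
  map_smul' c g := by rw [iterPrim_smul]; rfl

theorem iterPrim_zero (g : Lp ℂ 2 unitMeasure) (k : ℕ) : iterPrim g k 0 = 0 := by
  cases k <;> simp [iterPrim]

theorem iterPrim_sub (g : Lp ℂ 2 unitMeasure) (k : ℕ) (p x : ℝ) :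
    iterPrim g (k + 1) x - iterPrim g (k + 1) p = ∫ t in p..x, iterPrim g k t :=
  intervalIntegral.integral_interval_sub_left ((continuous_iterPrim g k).intervalIntegrable _ _)
    ((continuous_iterPrim g k).intervalIntegrable _ _)

/-- Cauchy–Schwarz, read off from the non-negative integral of the squared deviation of `‖g‖` from
its mean `I / A`. -/
theorem integral_norm_zeroExt_le (g : Lp ℂ 2 unitMeasure) (p : ℝ) {A : ℝ} (hA : 0 < A) :
    ∫ t in p..p + A, ‖zeroExt g t‖ ≤ √A * ‖g‖ := by
  set I := ∫ t in p..p + A, ‖zeroExt g t‖ with hI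
  have hle : p ≤ p + A := by linarith
  have hi : IntervalIntegrable (fun t => ‖zeroExt g t‖) volume p (p + A) :=
    (integrable_zeroExt g).norm.intervalIntegrable
  have hi2 : Integrable (fun t => ‖zeroExt g t‖ ^ 2) := (memLp_zeroExt g).integrable_norm_pow two_ne_zero
  have h0 : 0 ≤ ∫ t in p..p + A, (‖zeroExt g t‖ - I / A) ^ 2 :=
    intervalIntegral.integral_nonneg hle fun t _ => sq_nonneg _
  have he : ∫ t in p..p + A, (‖zeroExt g t‖ - I / A) ^ 2 =
      (∫ t in p..p + A, ‖zeroExt g t‖ ^ 2) - 2 * (I / A) * I + (I / A) ^ 2 * A := by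
    have : ∀ t, (‖zeroExt g t‖ - I / A) ^ 2 =
        (‖zeroExt g t‖ ^ 2 - 2 * (I / A) * ‖zeroExt g t‖) + (I / A) ^ 2 := fun t => by ring
    simp only [this]
    rw [intervalIntegral.integral_add (hi2.intervalIntegrable.sub (hi.const_mul _)) (by simp),
      intervalIntegral.integral_sub hi2.intervalIntegrable (hi.const_mul _),
      intervalIntegral.integral_const_mul, intervalIntegral.integral_const]
    simp only [smul_eq_mul]
    ring
  have h1 : ∫ t in p..p + A, ‖zeroExt g t‖ ^ 2 ≤ ‖g‖ ^ 2 := by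
    rw [norm_sq_eq_integral_zeroExt, intervalIntegral.integral_of_le hle]
    exact setIntegral_le_integral hi2 (Eventually.of_forall fun t => sq_nonneg _)
  have h2 : I ^ 2 ≤ (√A * ‖g‖) ^ 2 := by
    rw [mul_pow, Real.sq_sqrt hA.le]
    rw [he] at h0
    have : 2 * (I / A) * I - (I / A) ^ 2 * A = I ^ 2 / A := by field_simp; ring
    have h3 : I ^ 2 / A ≤ ‖g‖ ^ 2 := by linarith
    rwa [div_le_iff₀' hA] at h3
  exact le_of_sq_le_sq h2 (by positivity) 

/-- Cauchy–Schwarz yields `√A` at the bottom level, and each further integration from `p` yields a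
factor `A`. A product of two functions at level `n - 1` is thus of order `A ^ (2 * n - 1)`. -/
theorem norm_iterPrim_le (g : Lp ℂ 2 unitMeasure) (k : ℕ) {p A : ℝ} (hA : 0 < A)
    (h0 : ∀ i ≤ k, iterPrim g i p = 0) {x : ℝ} (hx : x ∈ Icc p (p + A)) :
    ‖iterPrim g k x‖ ≤ A ^ k * (√A * ‖g‖) := by
  induction k generalizing x with
  | zero =>
    have h1 : iterPrim g 0 x = ∫ t in p..x, zeroExt g t := by
      have : iterPrim g 0 x - iterPrim g 0 p = ∫ t in p..x, zeroExt g t :=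
        intervalIntegral.integral_interval_sub_left (integrable_zeroExt g).intervalIntegrable
          (integrable_zeroExt g).intervalIntegrable
      rwa [h0 0 le_rfl, sub_zero] at this
    rw [h1, pow_zero, one_mul]
    refine le_trans (intervalIntegral.norm_integral_le_integral_norm hx.1) ?_
    refine le_trans ?_ (integral_norm_zeroExt_le g p hA)
    exact intervalIntegral.integral_mono_interval le_rfl hx.1 hx.2
      (Eventually.of_forall fun t => norm_nonneg _)
      (integrable_zeroExt g).norm.intervalIntegrable
  | succ k ih =>
    have h1 := iterPrim_sub g k p x
    rw [h0 (k + 1) le_rfl, sub_zero] at h1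
    rw [h1]
    have h2 := intervalIntegral.norm_integral_le_of_norm_le_const (a := p) (b := x)
      (f := iterPrim g k) (C := A ^ k * (√A * ‖g‖)) fun t ht => by
        rw [uIoc_of_le hx.1] at ht
        exact ih (fun i hi => h0 i (hi.trans (Nat.le_succ k))) ⟨ht.1.le, ht.2.trans hx.2⟩
    refine h2.trans ?_
    rw [abs_of_nonneg (sub_nonneg.2 hx.1)]
    calc A ^ k * (√A * ‖g‖) * (x - p) ≤ A ^ k * (√A * ‖g‖) * A := by
          gcongr; linarith [hx.2]
      _ = A ^ (k + 1) * (√A * ‖g‖) := by ring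

theorem norm_iterPrim_le_norm (g : Lp ℂ 2 unitMeasure) (k : ℕ) {x : ℝ} (hx : x ∈ Icc (0 : ℝ) 1) :
    ‖iterPrim g k x‖ ≤ ‖g‖ := by
  have := norm_iterPrim_le g k (p := 0) (A := 1) one_pos (fun i _ => iterPrim_zero g i)
    (x := x) (by simpa using hx)
  simpa using this

/-- The square integrable functions whose first `n` iterated primitives vanish at `1`: the `n`-th
derivatives of the functions of `sobolevZero n`. -/
def momentFree (n : ℕ) : Submodule ℂ (Lp ℂ 2 unitMeasure) :=
  ⨅ k : Fin n, LinearMap.ker (iterPrimEval k 1)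

theorem mem_momentFree {n : ℕ} {g : Lp ℂ 2 unitMeasure} :
    g ∈ momentFree n ↔ ∀ k < n, iterPrim g k 1 = 0 := by
  simp only [momentFree, Submodule.mem_iInf, LinearMap.mem_ker]
  exact ⟨fun h k hk => h ⟨k, hk⟩, fun h k => h k k.2⟩

/-- Completeness is needed to represent the weight form by an operator and to apply the spectral
theorem. -/
instance (n : ℕ) : CompleteSpace (momentFree n) := by
  have hcl : IsClosed (momentFree n : Set (Lp ℂ 2 unitMeasure)) := by
    rw [momentFree, Submodule.coe_iInf]
    refine isClosed_iInter fun k => ?_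
    let f : Lp ℂ 2 unitMeasure →L[ℂ] ℂ := (iterPrimEval k 1).mkContinuous 1 fun g => by
      rw [one_mul]
      exact norm_iterPrim_le_norm g k (by simp)
    exact f.isClosed_ker
  exact hcl.completeSpace_coe

theorem iterPrim_eq_zero_of_nonpos (g : Lp ℂ 2 unitMeasure) (k : ℕ) {x : ℝ} (hx : x ≤ 0) :
    iterPrim g k x = 0 := by
  induction k generalizing x with
  | zero =>
    simp only [iterPrim]
    rw [intervalIntegral.integral_symm, intervalIntegral.integral_of_le hx, neg_eq_zero,
      ← integral_indicator measurableSet_Ioc]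
    refine integral_eq_zero_of_ae ?_
    have h0 : ∀ᵐ t : ℝ, t ≠ 0 := by simp [ae_iff, measure_singleton]
    filter_upwards [h0] with t ht
    by_cases hm : t ∈ Ioc x 0
    · rw [indicator_of_mem hm]
      exact zeroExt_of_notMem g fun h => ht (le_antisymm hm.2 h.1)
    · simp [hm]
  | succ k ih =>
    simp only [iterPrim]
    refine (intervalIntegral.integral_congr (g := fun _ => (0 : ℂ)) fun t ht => ?_).trans (by simp)
    rw [uIcc_of_ge hx] at ht
    exact ih ht.2

theorem iterPrim_eq_zero_of_one_le {g : Lp ℂ 2 unitMeasure} {k : ℕ}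
    (hg : ∀ i ≤ k, iterPrim g i 1 = 0) {x : ℝ} (hx : 1 ≤ x) : iterPrim g k x = 0 := by
  induction k generalizing x with
  | zero =>
    have h1 : iterPrim g 0 x - iterPrim g 0 1 = ∫ t in (1 : ℝ)..x, zeroExt g t :=
      intervalIntegral.integral_interval_sub_left (integrable_zeroExt g).intervalIntegrable
          (integrable_zeroExt g).intervalIntegrable
    rw [hg 0 le_rfl, sub_zero] at h1
    rw [h1, intervalIntegral.integral_of_le hx]
    refine setIntegral_eq_zero_of_forall_eq_zero fun t ht => ?_
    exact zeroExt_of_notMem g fun h => absurd h.2 (not_le.2 ht.1)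
  | succ k ih =>
    have h1 := iterPrim_sub g k 1 x
    rw [hg (k + 1) le_rfl, sub_zero] at h1
    rw [h1]
    refine (intervalIntegral.integral_congr (g := fun _ => (0 : ℂ)) fun t ht => ?_).trans (by simp)
    rw [uIcc_of_le hx] at ht
    exact ih (fun i hi => hg i (hi.trans (Nat.le_succ k))) ht.1

theorem iterPrim_mem_sobolevZero {n : ℕ} (hn : 1 ≤ n) {g : Lp ℂ 2 unitMeasure}
    (hg : g ∈ momentFree n) : iterPrim g (n - 1) ∈ sobolevZero n := by
  rw [mem_momentFree] at hg
  refine ⟨fun x hx => ?_, contDiff_iterPrim g (n - 1), g, Lp.memLp g, fun x hx => ?_⟩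
  · rcases le_or_gt x 0 with h | h
    · exact iterPrim_eq_zero_of_nonpos g _ h
    · exact iterPrim_eq_zero_of_one_le (fun i hi => hg i (by omega))
        (not_lt.1 fun h1 => hx ⟨h, h1⟩)
  · have := iteratedDeriv_iterPrim g (n - 1) 0
    rw [zero_add] at this
    rw [this]
    refine intervalIntegral.integral_congr_ae (Eventually.of_forall fun t ht => ?_)
    rw [uIoc_of_le hx.1] at ht
    exact indicator_of_mem (M := ℂ) (s := Icc (0 : ℝ) 1) ⟨ht.1.le, ht.2.trans hx.2⟩ g

theorem iteratedDeriv_eq_zero_of_notMem_Icc {y : ℝ → ℂ} (hy : ∀ x ∉ Ioo (0 : ℝ) 1, y x = 0) (k : ℕ)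
    {x : ℝ} (hx : x ∉ Icc (0 : ℝ) 1) : iteratedDeriv k y x = 0 := by
  have hopen : (Icc (0 : ℝ) 1)ᶜ ∈ 𝓝 x := isClosed_Icc.isOpen_compl.mem_nhds hx
  have : y =ᶠ[𝓝 x] fun _ => (0 : ℂ) := by
    filter_upwards [hopen] with t ht
    exact hy t fun h => ht (Ioo_subset_Icc_self h)
  rw [this.iteratedDeriv_eq]
  simp

/-- All derivatives of `y` up to order `n - 1` vanish at `0`, so repeated integration from `0`
recovers `y`; their vanishing at `1` is the moment condition. -/
theorem exists_iterPrim_eq {n : ℕ} (hn : 1 ≤ n) {y : ℝ → ℂ} (hy : y ∈ sobolevZero n) :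
    ∃ g ∈ momentFree n, iterPrim g (n - 1) = y := by
  obtain ⟨hy0, hyc, g, hg, hyg⟩ := hy
  have hcont : ∀ k ≤ n - 1, Continuous (iteratedDeriv k y) := fun k hk =>
    hyc.continuous_iteratedDeriv k (by exact_mod_cast hk)
  have hzero : ∀ k ≤ n - 1, ∀ x ∉ Ioo (0 : ℝ) 1, iteratedDeriv k y x = 0 := by
    intro k hk x hx
    -- The endpoints are limits of points outside `[0, 1]`, where every derivative vanishes.
    have hx' : x ∈ closure (Icc (0 : ℝ) 1)ᶜ := by
      rw [closure_compl, interior_Icc]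
      exact hx
    have hcl : IsClosed {x | iteratedDeriv k y x = 0} := isClosed_eq (hcont k hk) continuous_const
    exact closure_minimal (fun t ht => iteratedDeriv_eq_zero_of_notMem_Icc hy0 k ht) hcl hx'
  set G : Lp ℂ 2 unitMeasure := hg.toLp g with hG
  have hGg : ∀ᵐ t, t ∈ Icc (0 : ℝ) 1 → zeroExt G t = g t := by
    have := hg.coeFn_toLp
    rw [Filter.EventuallyEq, ae_restrict_iff' measurableSet_Icc] at this
    filter_upwards [this] with t ht hm
    rw [zeroExt, indicator_of_mem hm, ht hm]
  have h01 : ∀ x ∈ Icc (0 : ℝ) 1, iterPrim G 0 x = iteratedDeriv (n - 1) y x := by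
    intro x hx
    rw [hyg x hx]
    refine intervalIntegral.integral_congr_ae (hGg.mono fun t ht hm => ht ?_)
    rw [uIoc_of_le hx.1] at hm
    exact ⟨hm.1.le, hm.2.trans hx.2⟩
  have h0 : iterPrim G 0 = iteratedDeriv (n - 1) y := by
    ext x
    by_cases hx : x ∈ Icc (0 : ℝ) 1
    · exact h01 x hx
    · rw [iteratedDeriv_eq_zero_of_notMem_Icc hy0 _ hx]
      rcases le_or_gt x 0 with h | h
      · exact iterPrim_eq_zero_of_nonpos G 0 h
      · refine iterPrim_eq_zero_of_one_le (fun i hi => ?_) (not_lt.1 fun h1 => hx ⟨h.le, h1.le⟩)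
        rw [Nat.le_zero.1 hi, h01 1 (by simp)]
        exact hzero _ le_rfl 1 (by simp)
  have hk : ∀ k ≤ n - 1, iterPrim G k = iteratedDeriv (n - 1 - k) y := by
    intro k
    induction k with
    | zero => exact fun _ => h0
    | succ k ih =>
      intro hk
      ext x
      have hd : ∀ t, HasDerivAt (iteratedDeriv (n - 1 - (k + 1)) y)
          (iteratedDeriv (n - 1 - k) y t) t := by
        intro t
        have hdiff : Differentiable ℝ (iteratedDeriv (n - 1 - (k + 1)) y) :=
          hyc.differentiable_iteratedDeriv _ (by exact_mod_cast (by omega))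
        have := (hdiff t).hasDerivAt
        rwa [← iteratedDeriv_succ, show n - 1 - (k + 1) + 1 = n - 1 - k by omega] at this
      have := intervalIntegral.integral_eq_sub_of_hasDerivAt (a := 0) (b := x)
        (fun t _ => hd t) ((hcont _ (by omega)).intervalIntegrable _ _)
      rw [hzero _ (by omega) 0 (by simp), sub_zero] at this
      rw [← this, ← ih (by omega)]
      rfl
  refine ⟨G, mem_momentFree.2 fun k hkn => ?_, ?_⟩
  · rw [hk k (by omega)]
    exact hzero _ (by omega) 1 (by simp)
  · rw [hk (n - 1) le_rfl, Nat.sub_self, iteratedDeriv_zero]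

/-- Lebesgue's differentiation theorem supplies the last derivative. -/
theorem iteratedDeriv_iterPrim_ae {n : ℕ} (hn : 2 ≤ n) (g : Lp ℂ 2 unitMeasure) :
    iteratedDeriv n (iterPrim g (n - 1)) =ᵐ[volume] zeroExt g := by
  have h := iteratedDeriv_iterPrim g (n - 1) 0
  rw [zero_add] at h
  rw [iteratedDeriv_eq_deriv_pred hn, h]
  have hl : LocallyIntegrable (zeroExt g) := (integrable_zeroExt g).locallyIntegrable
  filter_upwards [LocallyIntegrable.ae_hasDerivAt_integral hl] with x hx
  exact (hx 0).deriv

/-- The function of the energy space with a given `n`-th derivative. -/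
def sobolevOf (n : ℕ) (hn : 2 ≤ n) : momentFree n →ₗ[ℂ] sobolevZero n where
  toFun g := ⟨iterPrim g.1 (n - 1), iterPrim_mem_sobolevZero (by omega) g.2⟩
  map_add' g h := Subtype.ext (iterPrim_add g.1 h.1 (n - 1))
  map_smul' c g := Subtype.ext (iterPrim_smul c g.1 (n - 1))

theorem sobolevOf_bijective (n : ℕ) (hn : 2 ≤ n) : Function.Bijective (sobolevOf n hn) := by
  constructor
  · refine (injective_iff_map_eq_zero _).2 fun g hg => ?_
    have h0 : iterPrim g.1 (n - 1) = 0 := congrArg Subtype.val hg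
    have h1 := iteratedDeriv_iterPrim_ae hn g.1
    rw [h0] at h1
    have h2 := norm_sq_eq_integral_zeroExt g.1
    rw [integral_congr_ae (g := fun _ => (0 : ℝ)) (h1.mono fun x hx => by
      rw [← hx]; simp [Pi.zero_def])] at h2
    simpa using h2
  · rintro ⟨y, hy⟩
    obtain ⟨g, hg, hgy⟩ := exists_iterPrim_eq (by omega) hy
    exact ⟨⟨g, hg⟩, Subtype.ext hgy⟩

/-- The isomorphism of the energy space with the space of `n`-th derivatives. -/
def sobolevEquiv (n : ℕ) (hn : 2 ≤ n) : momentFree n ≃ₗ[ℂ] sobolevZero n :=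
  LinearEquiv.ofBijective (sobolevOf n hn) (sobolevOf_bijective n hn)

theorem sobolevEquiv_apply {n : ℕ} (hn : 2 ≤ n) (g : momentFree n) :
    (sobolevEquiv n hn g).1 = iterPrim g.1 (n - 1) := rfl
end

/-! ### Self-similarity of the generalized derivative of `P`. -/

noncomputable section

/-- `P` is self-similar with the given parameters, exactly one of the `d k` being non-zero, and
that one negative. -/
structure IsSimpleSelfSimilar (N m : ℕ) (a β d : ℕ → ℝ) (P : Lp ℝ 2 unitMeasure) : Prop where
  two_le : 2 ≤ N
  a_pos : ∀ k ∈ Finset.Icc 1 N, 0 < a k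
  a_sum : ∑ k ∈ Finset.Icc 1 N, a k = 1
  contr : ∑ k ∈ Finset.Icc 1 N, a k * |d k| ^ 2 < 1
  m_mem : m ∈ Finset.Icc 1 N
  d_eq_zero : ∀ k ∈ Finset.Icc 1 N, k ≠ m → d k = 0
  d_neg : d m < 0
  eq_similarityOp : (P : ℝ → ℝ) =ᵐ[unitMeasure] similarityOp N a β d P

/-- The affine map of `[0, 1]` onto the `k`-th interval of the partition. -/
def pieceMap (a : ℕ → ℝ) (k : ℕ) (x : ℝ) : ℝ := breakpoint a (k - 1) + a k * x

/-- The integral of `f` with respect to the generalized derivative of `P` on `(0, 1)`. -/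
def jumpForm (N : ℕ) (β d : ℕ → ℝ) (P : Lp ℝ 2 unitMeasure) (f : ℝ → ℂ) : ℂ :=
  -- The values assigned to `P` at `1` and `0` are the fixed points of the last and first branches.
  -- Boundary terms must be kept because `f ∘ pieceMap a m` need not vanish at the ends even if `f`
  -- does.
  ((β N / (1 - d N) : ℝ) : ℂ) * f 1 - ((β 1 / (1 - d 1) : ℝ) : ℂ) * f 0 -
    ∫ x in Icc (0 : ℝ) 1, ((P x : ℝ) : ℂ) * deriv f x

theorem integrable_Lp_mul_deriv (P : Lp ℝ 2 unitMeasure) {f : ℝ → ℂ} (hf : ContDiff ℝ 1 f) :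
    Integrable (fun x => ((P x : ℝ) : ℂ) * deriv f x) unitMeasure :=
  IntegrableOn.mul_continuousOn ((Lp.memLp P).integrable (by norm_num)).ofReal
    (hf.continuous_deriv le_rfl).continuousOn isCompact_Icc

section JumpForm

variable {N m : ℕ} {a β d : ℕ → ℝ} {P : Lp ℝ 2 unitMeasure}

theorem jumpForm_add {f g : ℝ → ℂ} (hf : ContDiff ℝ 1 f) (hg : ContDiff ℝ 1 g) :
    jumpForm N β d P (f + g) = jumpForm N β d P f + jumpForm N β d P g := by
  have : ∀ x, ((P x : ℝ) : ℂ) * deriv (f + g) x =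
      ((P x : ℝ) : ℂ) * deriv f x + ((P x : ℝ) : ℂ) * deriv g x := fun x => by
    rw [deriv_add (hf.differentiable one_ne_zero x) (hg.differentiable one_ne_zero x), mul_add]
  simp only [jumpForm, this, Pi.add_apply]
  rw [integral_add (integrable_Lp_mul_deriv P hf) (integrable_Lp_mul_deriv P hg)]
  ring

theorem jumpForm_smul (c : ℂ) (f : ℝ → ℂ) :
    jumpForm N β d P (c • f) = c * jumpForm N β d P f := by
  have : ∀ x, ((P x : ℝ) : ℂ) * deriv (c • f) x = c * (((P x : ℝ) : ℂ) * deriv f x) := fun x => by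
    have e : c • f = fun t => c * f t := rfl
    rw [e, deriv_const_mul_field]
    ring
  simp only [jumpForm, this, Pi.smul_apply, smul_eq_mul]
  rw [integral_const_mul]
  ring

theorem jumpForm_conj (f : ℝ → ℂ) :
    jumpForm N β d P (fun t => starRingEnd ℂ (f t)) = starRingEnd ℂ (jumpForm N β d P f) := by
  have h : ∀ x, deriv (fun t => starRingEnd ℂ (f t)) x = starRingEnd ℂ (deriv f x) := fun x => by
    have := deriv.star (f := f) (x := x)
    exact this
  simp only [jumpForm, map_sub, map_mul, Complex.conj_ofReal, ← integral_conj, h]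

theorem jumpForm_eq_zero {f : ℝ → ℂ} (hf : ∀ x ∈ Icc (0 : ℝ) 1, f x = 0) :
    jumpForm N β d P f = 0 := by
  have h : ∫ x in Icc (0 : ℝ) 1, ((P x : ℝ) : ℂ) * deriv f x = 0 := by
    rw [integral_Icc_eq_integral_Ioo]
    refine setIntegral_eq_zero_of_forall_eq_zero fun x hx => ?_
    have : f =ᶠ[𝓝 x] fun _ => (0 : ℂ) := by
      filter_upwards [isOpen_Ioo.mem_nhds hx] with t ht
      exact hf t (Ioo_subset_Icc_self ht)
    rw [this.deriv_eq]
    simp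
  rw [jumpForm, h, hf 0 (by simp), hf 1 (by simp)]
  simp

/-- A constant controlling `jumpForm`. -/
def jumpBound (N : ℕ) (β d : ℕ → ℝ) (P : Lp ℝ 2 unitMeasure) : ℝ :=
  |β N / (1 - d N)| + |β 1 / (1 - d 1)| + ∫ x in Icc (0 : ℝ) 1, |P x|

theorem jumpBound_nonneg : 0 ≤ jumpBound N β d P := by
  have : 0 ≤ ∫ x in Icc (0 : ℝ) 1, |P x| := integral_nonneg fun x => abs_nonneg _
  unfold jumpBound
  positivity

theorem norm_jumpForm_le {f : ℝ → ℂ} {K : ℝ} (hf : ∀ x ∈ Icc (0 : ℝ) 1, ‖f x‖ ≤ K)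
    (hf' : ∀ x ∈ Icc (0 : ℝ) 1, ‖deriv f x‖ ≤ K) :
    ‖jumpForm N β d P f‖ ≤ jumpBound N β d P * K := by
  have hP : Integrable (fun x => P x) unitMeasure := (Lp.memLp P).integrable (by norm_num)
  have h1 : ‖∫ x in Icc (0 : ℝ) 1, ((P x : ℝ) : ℂ) * deriv f x‖ ≤
      (∫ x in Icc (0 : ℝ) 1, |P x|) * K := by
    rw [← integral_mul_const]
    refine norm_integral_le_of_norm_le (hP.abs.mul_const K) ?_
    filter_upwards [ae_restrict_mem measurableSet_Icc] with x hx
    rw [norm_mul, Complex.norm_real, Real.norm_eq_abs]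
    exact mul_le_mul_of_nonneg_left (hf' x hx) (abs_nonneg _)
  have h2 : ‖((β N / (1 - d N) : ℝ) : ℂ) * f 1‖ ≤ |β N / (1 - d N)| * K := by
    rw [norm_mul, Complex.norm_real, Real.norm_eq_abs]
    exact mul_le_mul_of_nonneg_left (hf 1 (by simp)) (abs_nonneg _)
  have h3 : ‖((β 1 / (1 - d 1) : ℝ) : ℂ) * f 0‖ ≤ |β 1 / (1 - d 1)| * K := by
    rw [norm_mul, Complex.norm_real, Real.norm_eq_abs]
    exact mul_le_mul_of_nonneg_left (hf 0 (by simp)) (abs_nonneg _)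
  unfold jumpForm jumpBound
  rw [add_mul, add_mul]
  exact (norm_sub_le _ _).trans (add_le_add ((norm_sub_le _ _).trans (add_le_add h2 h3)) h1)

theorem breakpoint_succ (k : ℕ) : breakpoint a (k + 1) = breakpoint a k + a (k + 1) := by
  unfold breakpoint
  rw [Finset.sum_Icc_succ_top (by omega)]

theorem breakpoint_zero : breakpoint a 0 = 0 := by simp [breakpoint]

theorem contDiff_comp_pieceMap {f : ℝ → ℂ} (hf : ContDiff ℝ 1 f) (k : ℕ) :
    ContDiff ℝ 1 (f ∘ pieceMap a k) := by
  refine hf.comp ?_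
  unfold pieceMap
  fun_prop

namespace IsSimpleSelfSimilar

variable (h : IsSimpleSelfSimilar N m a β d P)
include h

theorem breakpoint_strictMono {i j : ℕ} (hij : i < j) (hj : j ≤ N) :
    breakpoint a i < breakpoint a j := by
  induction j, hij using Nat.le_induction with
  | base =>
    rw [breakpoint_succ]
    linarith [h.a_pos (i + 1) (Finset.mem_Icc.2 ⟨by omega, hj⟩)]
  | succ j hij ih =>
    rw [breakpoint_succ]
    linarith [h.a_pos (j + 1) (Finset.mem_Icc.2 ⟨by omega, hj⟩), ih (by omega)]

theorem breakpoint_mono {i j : ℕ} (hij : i ≤ j) (hj : j ≤ N) :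
    breakpoint a i ≤ breakpoint a j := by
  rcases hij.eq_or_lt with rfl | hlt
  · exact le_rfl
  · exact (h.breakpoint_strictMono hlt hj).le

theorem breakpoint_last : breakpoint a N = 1 := h.a_sum

theorem breakpoint_mem {i : ℕ} (hi : i ≤ N) : breakpoint a i ∈ Icc (0 : ℝ) 1 := by
  rw [← breakpoint_zero (a := a), ← h.breakpoint_last]
  exact ⟨h.breakpoint_mono (Nat.zero_le _) hi, h.breakpoint_mono hi le_rfl⟩

theorem d_nonpos {k : ℕ} (hk : k ∈ Finset.Icc 1 N) : d k ≤ 0 := by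
  by_cases hkm : k = m
  · exact hkm ▸ h.d_neg.le
  · exact (h.d_eq_zero k hk hkm).le

theorem similarityOp_eq {k : ℕ} (hk : k < N) {f : ℝ → ℝ} {x : ℝ}
    (hx : x ∈ Ioo (breakpoint a k) (breakpoint a (k + 1))) :
    similarityOp N a β d f x = β (k + 1) + d (k + 1) * f ((x - breakpoint a k) / a (k + 1)) := by
  unfold similarityOp
  rw [Finset.sum_eq_single (k + 1)]
  · rw [Nat.add_sub_cancel, indicator_of_mem hx]
  · intro j hj hjk
    refine indicator_of_notMem (fun hxj => ?_) _
    have hj' := Finset.mem_Icc.1 hj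
    rcases lt_or_gt_of_ne hjk with hlt | hlt
    · have := h.breakpoint_mono (show j ≤ k by omega) hk.le
      linarith [hxj.2, hx.1]
    · have := h.breakpoint_mono (show k + 1 ≤ j - 1 by omega) (by omega)
      linarith [hxj.1, hx.2]
  · intro hk'
    exact absurd (Finset.mem_Icc.2 ⟨by omega, hk⟩) hk'

theorem intervalIntegrable_mul_deriv {f : ℝ → ℂ} (hf : ContDiff ℝ 1 f) {i j : ℕ} (hi : i ≤ N)
    (hj : j ≤ N) : IntervalIntegrable (fun x => ((P x : ℝ) : ℂ) * deriv f x) volume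
      (breakpoint a i) (breakpoint a j) := by
  have h1 : IntervalIntegrable (fun x => ((P x : ℝ) : ℂ) * deriv f x) volume 0 1 :=
    (intervalIntegrable_iff_integrableOn_Icc_of_le zero_le_one).2 (integrable_Lp_mul_deriv P hf)
  refine h1.mono_set ?_
  rw [uIcc_of_le zero_le_one]
  exact uIcc_subset_Icc (h.breakpoint_mem hi) (h.breakpoint_mem hj)

/-- Almost everywhere on this piece `P` is a constant plus `d (k + 1)` times a rescaled copy of `P`;
a linear change of variables does the rest. -/
theorem integral_piece {f : ℝ → ℂ} (hf : ContDiff ℝ 1 f) {k : ℕ} (hk : k < N) :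
    ∫ x in breakpoint a k..breakpoint a (k + 1), ((P x : ℝ) : ℂ) * deriv f x =
      β (k + 1) * (f (breakpoint a (k + 1)) - f (breakpoint a k)) +
        d (k + 1) * ∫ x in Icc (0 : ℝ) 1, ((P x : ℝ) : ℂ) * deriv (f ∘ pieceMap a (k + 1)) x := by
  have ha : 0 < a (k + 1) := h.a_pos _ (Finset.mem_Icc.2 ⟨by omega, hk⟩)
  have hlt := h.breakpoint_strictMono (Nat.lt_succ_self k) hk
  have hcong : ∫ x in breakpoint a k..breakpoint a (k + 1), ((P x : ℝ) : ℂ) * deriv f x =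
      ∫ x in breakpoint a k..breakpoint a (k + 1),
        ((β (k + 1) + d (k + 1) * P ((x - breakpoint a k) / a (k + 1)) : ℝ) : ℂ) * deriv f x := by
    refine intervalIntegral.integral_congr_ae ?_
    have h1 := h.eq_similarityOp
    rw [Filter.EventuallyEq, ae_restrict_iff' measurableSet_Icc] at h1
    have h2 : ∀ᵐ x : ℝ, x ≠ breakpoint a (k + 1) := by simp [ae_iff, measure_singleton]
    filter_upwards [h1, h2] with x hx hx2 hxm
    rw [uIoc_of_le hlt.le] at hxm
    have hb1 := h.breakpoint_mem hk.le
    have hb2 := h.breakpoint_mem (Nat.succ_le_of_lt hk)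
    rw [hx ⟨hb1.1.trans hxm.1.le, hxm.2.trans hb2.2⟩,
      h.similarityOp_eq hk ⟨hxm.1, lt_of_le_of_ne hxm.2 hx2⟩]
  have hder : ∀ t, deriv (f ∘ pieceMap a (k + 1)) t =
      a (k + 1) * deriv f (breakpoint a k + a (k + 1) * t) := by
    intro t
    have h1 : HasDerivAt (pieceMap a (k + 1)) (a (k + 1)) t := by
      unfold pieceMap
      simpa using ((hasDerivAt_id t).const_mul (a (k + 1))).const_add (breakpoint a k)
    have h2 := (hf.differentiable one_ne_zero (pieceMap a (k + 1) t)).hasDerivAt.scomp t h1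
    rw [h2.deriv, Complex.real_smul]
    rfl
  have hsub := intervalIntegral.smul_integral_comp_add_mul (a := 0) (b := 1)
    (fun x => ((β (k + 1) + d (k + 1) * P ((x - breakpoint a k) / a (k + 1)) : ℝ) : ℂ) * deriv f x)
    (a (k + 1)) (breakpoint a k)
  rw [mul_zero, add_zero, mul_one, ← breakpoint_succ] at hsub
  rw [hcong, ← hsub, ← intervalIntegral.integral_smul]
  have hcs := contDiff_comp_pieceMap (a := a) hf (k + 1)
  have hint : ∀ t, a (k + 1) • (((β (k + 1) + d (k + 1) *
      P ((breakpoint a k + a (k + 1) * t - breakpoint a k) / a (k + 1)) : ℝ) : ℂ) *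
        deriv f (breakpoint a k + a (k + 1) * t)) =
      β (k + 1) * deriv (f ∘ pieceMap a (k + 1)) t +
        d (k + 1) * (((P t : ℝ) : ℂ) * deriv (f ∘ pieceMap a (k + 1)) t) := by
    intro t
    rw [add_sub_cancel_left, mul_div_cancel_left₀ _ ha.ne', hder, Complex.real_smul]
    push_cast
    ring
  simp only [hint]
  have hi1 : IntervalIntegrable (deriv (f ∘ pieceMap a (k + 1))) volume 0 1 :=
    (hcs.continuous_deriv le_rfl).intervalIntegrable _ _
  have hi2 : IntervalIntegrable (fun t => ((P t : ℝ) : ℂ) * deriv (f ∘ pieceMap a (k + 1)) t)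
      volume 0 1 :=
    (intervalIntegrable_iff_integrableOn_Icc_of_le zero_le_one).2 (integrable_Lp_mul_deriv P hcs)
  rw [intervalIntegral.integral_add (hi1.const_mul _) (hi2.const_mul _),
    intervalIntegral.integral_const_mul, intervalIntegral.integral_const_mul,
    intervalIntegral.integral_deriv_eq_sub (fun x _ => hcs.differentiable one_ne_zero x) hi1,
    intervalIntegral.integral_of_le zero_le_one, ← integral_Icc_eq_integral_Ioc]
  simp [pieceMap, breakpoint_succ]

/-- Explains the `ζ_k`: each is the formal jump at `α_k`, right value minus left value, once `P` has
its fixed-point values at `0` and `1`. -/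
theorem zetaCoeff_eq {k : ℕ} (hk1 : 1 ≤ k) (hk : k < N) :
    zetaCoeff N m β d k = β (k + 1) + d (k + 1) * (β 1 / (1 - d 1)) -
      (β k + d k * (β N / (1 - d N))) := by
  have hm := Finset.mem_Icc.1 h.m_mem
  have hk' : k ∈ Finset.Icc 1 N := Finset.mem_Icc.2 ⟨hk1, hk.le⟩
  have hk'' : k + 1 ∈ Finset.Icc 1 N := Finset.mem_Icc.2 ⟨by omega, hk⟩
  unfold zetaCoeff
  split_ifs with h1 h2
  · have hd1 : d 1 = 0 := h.d_eq_zero 1 (Finset.mem_Icc.2 ⟨le_rfl, by omega⟩) (by omega)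
    rw [hd1, h.d_eq_zero k hk' (by omega), h1, show k = m - 1 by omega]
    ring
  · have hdN : d N = 0 := h.d_eq_zero N (Finset.mem_Icc.2 ⟨by omega, le_rfl⟩) (by omega)
    rw [hdN, h.d_eq_zero (k + 1) hk'' (by omega), h2]
    ring
  · rw [h.d_eq_zero k hk' (by omega), h.d_eq_zero (k + 1) hk'' (by omega)]
    ring

/-- The self-similarity of the generalized derivative of `P`. -/
theorem jumpForm_eq {f : ℝ → ℂ} (hf : ContDiff ℝ 1 f) :
    jumpForm N β d P f = ∑ k ∈ Finset.range (N - 1),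
      (zetaCoeff N m β d (k + 1) : ℂ) * f (breakpoint a (k + 1)) +
        d m * jumpForm N β d P (f ∘ pieceMap a m) := by
  obtain ⟨M, rfl⟩ : ∃ M, N = M + 1 := ⟨N - 1, by have := h.two_le; omega⟩
  set P0 : ℝ := β 1 / (1 - d 1) with hP0
  set P1 : ℝ := β (M + 1) / (1 - d (M + 1)) with hP1
  have hsum : ∫ x in Icc (0 : ℝ) 1, ((P x : ℝ) : ℂ) * deriv f x =
      ∑ k ∈ Finset.range (M + 1),
        ∫ x in breakpoint a k..breakpoint a (k + 1), ((P x : ℝ) : ℂ) * deriv f x := by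
    rw [intervalIntegral.sum_integral_adjacent_intervals fun k hk =>
      h.intervalIntegrable_mul_deriv hf hk.le (Nat.succ_le_of_lt hk), breakpoint_zero,
      h.breakpoint_last, intervalIntegral.integral_of_le zero_le_one, integral_Icc_eq_integral_Ioc]
  have hpiece : ∀ k ∈ Finset.range (M + 1),
      ∫ x in breakpoint a k..breakpoint a (k + 1), ((P x : ℝ) : ℂ) * deriv f x =
      (((β (k + 1) + d (k + 1) * P1 : ℝ) : ℂ) * f (breakpoint a (k + 1)) -
        ((β (k + 1) + d (k + 1) * P0 : ℝ) : ℂ) * f (breakpoint a k)) -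
        d (k + 1) * jumpForm (M + 1) β d P (f ∘ pieceMap a (k + 1)) := by
    intro k hk
    rw [h.integral_piece hf (Finset.mem_range.1 hk), jumpForm, ← hP0, ← hP1]
    simp only [Function.comp, pieceMap, Nat.add_sub_cancel, mul_zero, add_zero, mul_one,
      ← breakpoint_succ]
    push_cast
    ring
  have hlast : ∑ k ∈ Finset.range (M + 1),
      (d (k + 1) : ℂ) * jumpForm (M + 1) β d P (f ∘ pieceMap a (k + 1)) =
      d m * jumpForm (M + 1) β d P (f ∘ pieceMap a m) := by
    have hm := Finset.mem_Icc.1 h.m_mem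
    rw [Finset.sum_eq_single (m - 1)]
    · rw [Nat.sub_add_cancel hm.1]
    · intro k hk hkm
      rw [h.d_eq_zero (k + 1) (Finset.mem_Icc.2 ⟨by omega, by
        have := Finset.mem_range.1 hk; omega⟩) (by omega)]
      simp
    · intro hmem
      exact absurd (Finset.mem_range.2 (by omega)) hmem
  -- By the fixed-point property, here and in `e0`, the two ends of the rearranged sum over pieces
  -- reproduce the boundary terms of `jumpForm`. Since `d k ≤ 0`, the denominators are non-zero.
  have e1 : β (M + 1) + d (M + 1) * P1 = P1 := by
    have : 1 - d (M + 1) ≠ 0 := by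
      have := h.d_nonpos (k := M + 1) (Finset.mem_Icc.2 ⟨by omega, le_rfl⟩)
      linarith
    rw [hP1]; field_simp; ring
  have e0 : β 1 + d 1 * P0 = P0 := by
    have : 1 - d 1 ≠ 0 := by
      have := h.d_nonpos (k := 1) (Finset.mem_Icc.2 ⟨le_rfl, by omega⟩)
      linarith
    rw [hP0]; field_simp; ring
  have hz : ∀ k ∈ Finset.range M, (zetaCoeff (M + 1) m β d (k + 1) : ℂ) * f (breakpoint a (k + 1)) =
      ((β (k + 1 + 1) + d (k + 1 + 1) * P0 : ℝ) : ℂ) * f (breakpoint a (k + 1)) -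
        ((β (k + 1) + d (k + 1) * P1 : ℝ) : ℂ) * f (breakpoint a (k + 1)) := by
    intro k hk
    rw [h.zetaCoeff_eq (by omega) (by have := Finset.mem_range.1 hk; omega), ← hP0, ← hP1]
    push_cast
    ring
  conv_lhs => rw [jumpForm, hsum, Finset.sum_congr rfl hpiece, ← hP0, ← hP1]
  rw [Finset.sum_sub_distrib, hlast, Finset.sum_sub_distrib, Finset.sum_range_succ,
    Finset.sum_range_succ' (fun k => ((β (k + 1) + d (k + 1) * P0 : ℝ) : ℂ) * f (breakpoint a k)),
    Nat.add_sub_cancel, Finset.sum_congr rfl hz, Finset.sum_sub_distrib]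
  simp only [zero_add]
  rw [e1, e0, h.breakpoint_last, breakpoint_zero]
  ring

/-- Unfolds `K` generations: the point masses of generation `j` carry the weights `d_m^j ζ_k`. -/
theorem jumpForm_iterate {f : ℝ → ℂ} (hf : ContDiff ℝ 1 f) (K : ℕ) :
    jumpForm N β d P f = ∑ j ∈ Finset.range K, (d m : ℂ) ^ j * ∑ k ∈ Finset.range (N - 1),
      (zetaCoeff N m β d (k + 1) : ℂ) * f ((pieceMap a m)^[j] (breakpoint a (k + 1))) +
        (d m : ℂ) ^ K * jumpForm N β d P (f ∘ (pieceMap a m)^[K]) := by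
  have hc : ∀ K, ContDiff ℝ 1 (f ∘ (pieceMap a m)^[K]) := by
    intro K
    induction K with
    | zero => exact hf
    | succ K ih =>
      rw [Function.iterate_succ, ← Function.comp_assoc]
      exact contDiff_comp_pieceMap ih m
  induction K with
  | zero => simp
  | succ K ih =>
    rw [ih, h.jumpForm_eq (hc K), Finset.sum_range_succ, Function.iterate_succ]
    simp only [Function.comp_def]
    ring

end IsSimpleSelfSimilar

end JumpForm
end

/-! ### The weight operator and the smallness of its tails. -/

noncomputable section

/-- The product of the functions with given `n`-th derivatives, the first one conjugated. -/
def conjProd (n : ℕ) (g h : Lp ℂ 2 unitMeasure) (t : ℝ) : ℂ :=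
  starRingEnd ℂ (iterPrim g (n - 1) t) * iterPrim h (n - 1) t

theorem contDiff_one_iterPrim {n : ℕ} (hn : 2 ≤ n) (g : Lp ℂ 2 unitMeasure) :
    ContDiff ℝ 1 (iterPrim g (n - 1)) :=
  (contDiff_iterPrim g (n - 1)).of_le (by exact_mod_cast (by omega : 1 ≤ n - 1))

theorem contDiff_conjProd {n : ℕ} (hn : 2 ≤ n) (g h : Lp ℂ 2 unitMeasure) :
    ContDiff ℝ 1 (conjProd n g h) :=
  (Complex.conjCLE.contDiff.comp (contDiff_one_iterPrim hn g)).mul (contDiff_one_iterPrim hn h)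

section

variable {N m : ℕ} {a β d : ℕ → ℝ} {P : Lp ℝ 2 unitMeasure}

/-- On `[p, p + A]` the two functions are of order `A^(n-1/2)` and their derivatives of order
`A^(n-3/2)`. The chain rule returns a factor `A`, so the rescaled product and its derivative are
both of order `A^(2n-1)`. -/
theorem norm_jumpForm_conjProd_comp_le {n : ℕ} (hn : 2 ≤ n) (g h : Lp ℂ 2 unitMeasure) {p A : ℝ}
    (hA : 0 < A) (hg : ∀ i < n, iterPrim g i p = 0) (hh : ∀ i < n, iterPrim h i p = 0) :
    ‖jumpForm N β d P (conjProd n g h ∘ fun x => p + A * x)‖ ≤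
      2 * jumpBound N β d P * A ^ (2 * n - 1) * ‖g‖ * ‖h‖ := by
  obtain ⟨r, rfl⟩ : ∃ r, n = r + 2 := ⟨n - 2, by omega⟩
  have hmem : ∀ x ∈ Icc (0 : ℝ) 1, p + A * x ∈ Icc p (p + A) := fun x hx =>
    ⟨by nlinarith [hx.1], by nlinarith [hx.2]⟩
  have hs : √A * √A = A := Real.mul_self_sqrt hA.le
  have hexp : 2 * (r + 2) - 1 = (r + 1) + (r + 1) + 1 := by omega
  have b1 : ∀ (u : Lp ℂ 2 unitMeasure), (∀ i < r + 2, iterPrim u i p = 0) → ∀ x ∈ Icc (0 : ℝ) 1,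
      ‖iterPrim u (r + 1) (p + A * x)‖ ≤ A ^ (r + 1) * (√A * ‖u‖) := fun u hu x hx =>
    norm_iterPrim_le u _ hA (fun i hi => hu i (by omega)) (hmem x hx)
  have b0 : ∀ (u : Lp ℂ 2 unitMeasure), (∀ i < r + 2, iterPrim u i p = 0) → ∀ x ∈ Icc (0 : ℝ) 1,
      ‖iterPrim u r (p + A * x)‖ ≤ A ^ r * (√A * ‖u‖) := fun u hu x hx =>
    norm_iterPrim_le u _ hA (fun i hi => hu i (by omega)) (hmem x hx)
  have key : ‖jumpForm N β d P (conjProd (r + 2) g h ∘ fun x => p + A * x)‖ ≤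
      jumpBound N β d P * (2 * A ^ (2 * (r + 2) - 1) * ‖g‖ * ‖h‖) := by
    refine norm_jumpForm_le (fun x hx => ?_) fun x hx => ?_
    · have e : A ^ (r + 1) * (√A * ‖g‖) * (A ^ (r + 1) * (√A * ‖h‖)) =
          A ^ (2 * (r + 2) - 1) * ‖g‖ * ‖h‖ := by
        rw [hexp, pow_succ, pow_add]
        linear_combination A ^ (r + 1) * A ^ (r + 1) * ‖g‖ * ‖h‖ * hs
      have e0 : 0 ≤ A ^ (2 * (r + 2) - 1) * ‖g‖ * ‖h‖ := by positivity
      calc ‖(conjProd (r + 2) g h ∘ fun x => p + A * x) x‖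
          = ‖iterPrim g (r + 1) (p + A * x)‖ * ‖iterPrim h (r + 1) (p + A * x)‖ := by
            simp [conjProd]
        _ ≤ A ^ (r + 1) * (√A * ‖g‖) * (A ^ (r + 1) * (√A * ‖h‖)) := by
            gcongr
            · exact b1 g hg x hx
            · exact b1 h hh x hx
        _ ≤ 2 * A ^ (2 * (r + 2) - 1) * ‖g‖ * ‖h‖ := by rw [e]; linarith
    · have hlin : HasDerivAt (fun x => p + A * x) A x := by
        simpa using ((hasDerivAt_id x).const_mul A).const_add p
      have hd : ∀ u : Lp ℂ 2 unitMeasure, HasDerivAt (fun x => iterPrim u (r + 1) (p + A * x))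
          (A • iterPrim u r (p + A * x)) x := fun u =>
        HasDerivAt.scomp (g₁ := iterPrim u (r + 1)) x
          (hasDerivAt_iterPrim_succ u r (p + A * x)) hlin
      have hd2 := ((hd g).star).mul (hd h)
      have hd3 : deriv (conjProd (r + 2) g h ∘ fun x => p + A * x) x =
          star (A • iterPrim g r (p + A * x)) * iterPrim h (r + 1) (p + A * x) +
            star (iterPrim g (r + 1) (p + A * x)) * (A • iterPrim h r (p + A * x)) := hd2.deriv
      rw [hd3]
      refine (norm_add_le _ _).trans ?_
      rw [norm_mul, norm_mul, norm_star, norm_star, norm_smul, norm_smul, Real.norm_of_nonneg hA.le]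
      have e : A * (A ^ r * (√A * ‖g‖)) * (A ^ (r + 1) * (√A * ‖h‖)) +
          A ^ (r + 1) * (√A * ‖g‖) * (A * (A ^ r * (√A * ‖h‖))) =
          2 * A ^ (2 * (r + 2) - 1) * ‖g‖ * ‖h‖ := by
        rw [hexp, pow_succ A (r + 1 + (r + 1)), pow_add A (r + 1), pow_succ A r]
        linear_combination 2 * (A ^ r * A) * (A ^ r * A) * ‖g‖ * ‖h‖ * hs
      rw [← e]
      gcongr
      · exact b0 g hg x hx
      · exact b1 h hh x hx
      · exact b1 g hg x hx
      · exact b0 h hh x hx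
  refine key.trans (le_of_eq ?_)
  ring

/-- The form `(g, h) ↦ ⟨P', ȳ z⟩` in terms of the `n`-th derivatives `g`, `h` of `y`, `z`. -/
def weightForm (n : ℕ) (hn : 2 ≤ n) (N : ℕ) (β d : ℕ → ℝ) (P : Lp ℝ 2 unitMeasure) :
    momentFree n →ₗ⋆[ℂ] momentFree n →ₗ[ℂ] ℂ :=
  LinearMap.mk₂'ₛₗ (starRingEnd ℂ) (RingHom.id ℂ)
    (fun g h => jumpForm N β d P (conjProd n g.1 h.1))
    (fun g g' h => by
      rw [← jumpForm_add (contDiff_conjProd hn _ _) (contDiff_conjProd hn _ _)]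
      congr 1
      ext t
      simp only [conjProd, Submodule.coe_add, iterPrim_add, Pi.add_apply, map_add]
      ring)
    (fun c g h => by
      rw [smul_eq_mul, ← jumpForm_smul]
      congr 1
      ext t
      simp only [conjProd, Submodule.coe_smul, iterPrim_smul, Pi.smul_apply, smul_eq_mul, map_mul]
      ring)
    (fun g h h' => by
      rw [← jumpForm_add (contDiff_conjProd hn _ _) (contDiff_conjProd hn _ _)]
      congr 1
      ext t
      simp only [conjProd, Submodule.coe_add, iterPrim_add, Pi.add_apply]
      ring)
    (fun c g h => by
      rw [RingHom.id_apply, smul_eq_mul, ← jumpForm_smul]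
      congr 1
      ext t
      simp only [conjProd, Submodule.coe_smul, iterPrim_smul, Pi.smul_apply, smul_eq_mul]
      ring)

/-- The bounded operator representing `weightForm`. -/
def weightOp (n : ℕ) (hn : 2 ≤ n) (N : ℕ) (β d : ℕ → ℝ) (P : Lp ℝ 2 unitMeasure) :
    momentFree n →L[ℂ] momentFree n :=
  InnerProductSpace.continuousLinearMapOfBilin
    ((weightForm n hn N β d P).mkContinuous₂ (2 * jumpBound N β d P) fun g h => by
      have := norm_jumpForm_conjProd_comp_le (N := N) (β := β) (d := d) (P := P) hn g.1 h.1
        (p := 0) (A := 1) one_pos (fun i _ => iterPrim_zero _ i) fun i _ => iterPrim_zero _ i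
      simp only [zero_add, one_mul, one_pow, mul_one] at this
      exact this)

theorem inner_weightOp {n : ℕ} (hn : 2 ≤ n) (g h : momentFree n) :
    inner ℂ (weightOp n hn N β d P g) h = jumpForm N β d P (conjProd n g.1 h.1) := by
  rw [weightOp, InnerProductSpace.continuousLinearMapOfBilin_apply]
  rfl

theorem conj_conjProd (n : ℕ) (g h : Lp ℂ 2 unitMeasure) :
    (fun t => starRingEnd ℂ (conjProd n g h t)) = conjProd n h g := by
  ext t
  simp only [conjProd, map_mul, Complex.conj_conj]
  ring

theorem weightOp_isSymmetric {n : ℕ} (hn : 2 ≤ n) :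
    ((weightOp n hn N β d P : momentFree n →L[ℂ] momentFree n) :
      momentFree n →ₗ[ℂ] momentFree n).IsSymmetric := by
  intro g h
  change inner ℂ (weightOp n hn N β d P g) h = inner ℂ g (weightOp n hn N β d P h)
  rw [← inner_conj_symm g, inner_weightOp, inner_weightOp, ← jumpForm_conj, conj_conjProd]

theorem iterate_pieceMap (K : ℕ) (x : ℝ) :
    (pieceMap a m)^[K] x = (pieceMap a m)^[K] 0 + a m ^ K * x := by
  induction K with
  | zero => simp
  | succ K ih =>
    rw [Function.iterate_succ_apply', Function.iterate_succ_apply', ih]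
    unfold pieceMap
    ring

namespace IsSimpleSelfSimilar

variable (hS : IsSimpleSelfSimilar N m a β d P)
include hS

theorem a_m_pos : 0 < a m := hS.a_pos m hS.m_mem

theorem a_m_lt_one : a m < 1 := by
  obtain ⟨k, hk, hkm⟩ : ∃ k ∈ Finset.Icc 1 N, k ≠ m := by
    have := hS.two_le
    by_cases h1 : m = 1
    · exact ⟨2, Finset.mem_Icc.2 ⟨by omega, by omega⟩, by omega⟩
    · exact ⟨1, Finset.mem_Icc.2 ⟨by omega, by omega⟩, fun h => h1 h.symm⟩
  rw [← hS.a_sum]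
  exact Finset.single_lt_sum hkm hS.m_mem hk (hS.a_pos k hk) fun j hj _ => (hS.a_pos j hj).le

theorem ratio_pos (n : ℕ) : 0 < a m ^ (2 * n - 1) * |d m| :=
  mul_pos (pow_pos hS.a_m_pos _) (abs_pos.2 hS.d_neg.ne)

/-- The contraction condition gives `a_m |d_m|² < 1`, and the square of the ratio is this number
times `a_m^(4n-3)`. -/
theorem ratio_lt_one {n : ℕ} (hn : 2 ≤ n) : a m ^ (2 * n - 1) * |d m| < 1 := by
  have h0 := hS.a_m_pos
  have h1 := hS.a_m_lt_one
  have h2 : a m * |d m| ^ 2 < 1 := lt_of_le_of_lt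
    (Finset.single_le_sum (f := fun k => a k * |d k| ^ 2)
      (fun k hk => mul_nonneg (hS.a_pos k hk).le (sq_nonneg _)) hS.m_mem) hS.contr
  refine lt_of_pow_lt_pow_left₀ 2 zero_le_one ?_
  obtain ⟨r, hr⟩ : ∃ r, (2 * n - 1) * 2 = r + 1 := ⟨(2 * n - 1) * 2 - 1, by omega⟩
  calc (a m ^ (2 * n - 1) * |d m|) ^ 2 = a m ^ r * (a m * |d m| ^ 2) := by
        rw [mul_pow, ← pow_mul, hr]; ring
    _ ≤ 1 * (a m * |d m| ^ 2) := by
        gcongr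
        exact pow_le_one₀ h0.le h1.le
    _ < 1 ^ 2 := by linarith

/-- The weight form of functions vanishing to order `n` at the left end of the `K`-th generation
interval is, up to a small error, a finite sum over the jumps of the first `K` generations. -/
theorem norm_inner_weightOp_sub_le {n : ℕ} (hn : 2 ≤ n) (K : ℕ) (g h : momentFree n)
    (hg : ∀ i < n, iterPrim g.1 i ((pieceMap a m)^[K] 0) = 0)
    (hh : ∀ i < n, iterPrim h.1 i ((pieceMap a m)^[K] 0) = 0) :
    ‖inner ℂ (weightOp n hn N β d P g) h - ∑ j ∈ Finset.range K, ∑ k ∈ Finset.range (N - 1),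
      ((d m ^ j * zetaCoeff N m β d (k + 1) : ℝ) : ℂ) *
        conjProd n g.1 h.1 ((pieceMap a m)^[j] (breakpoint a (k + 1)))‖ ≤
      2 * jumpBound N β d P * (a m ^ (2 * n - 1) * |d m|) ^ K * ‖g‖ * ‖h‖ := by
  rw [inner_weightOp, hS.jumpForm_iterate (contDiff_conjProd hn g.1 h.1) K]
  have e : ∀ j, (d m : ℂ) ^ j * ∑ k ∈ Finset.range (N - 1), (zetaCoeff N m β d (k + 1) : ℂ) *
      conjProd n g.1 h.1 ((pieceMap a m)^[j] (breakpoint a (k + 1))) =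
      ∑ k ∈ Finset.range (N - 1), ((d m ^ j * zetaCoeff N m β d (k + 1) : ℝ) : ℂ) *
        conjProd n g.1 h.1 ((pieceMap a m)^[j] (breakpoint a (k + 1))) := fun j => by
    rw [Finset.mul_sum]
    refine Finset.sum_congr rfl fun k _ => ?_
    push_cast
    ring
  simp only [e]
  rw [add_sub_cancel_left]
  have e2 : (pieceMap a m)^[K] = fun x => (pieceMap a m)^[K] 0 + a m ^ K * x :=
    funext (iterate_pieceMap K)
  rw [norm_mul, norm_pow, Complex.norm_real, Real.norm_eq_abs, e2]
  have b := norm_jumpForm_conjProd_comp_le (N := N) (β := β) (d := d) (P := P) hn g.1 h.1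
    (pow_pos hS.a_m_pos K) hg hh
  calc |d m| ^ K * ‖jumpForm N β d P (conjProd n g.1 h.1 ∘
        fun x => (pieceMap a m)^[K] 0 + a m ^ K * x)‖
      ≤ |d m| ^ K * (2 * jumpBound N β d P * (a m ^ K) ^ (2 * n - 1) * ‖g‖ * ‖h‖) := by
        gcongr; exact b
    _ = _ := by rw [mul_pow, ← pow_mul, ← pow_mul, mul_comm (2 * n - 1) K]; ring

/-- Vanishing at every jump of the first `K` generations, and to order `n` at the left end of the
`K`-th generation interval, leaves a remainder of order `q ^ K`. -/
theorem weightOp_hasSmallTails {n : ℕ} (hn : 2 ≤ n) : HasSmallTails (weightOp n hn N β d P) := by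
  intro ε hε
  set q := a m ^ (2 * n - 1) * |d m| with hq
  have hlim : Tendsto (fun K : ℕ => 2 * jumpBound N β d P * q ^ K) atTop (𝓝 0) := by
    simpa using (tendsto_pow_atTop_nhds_zero_of_lt_one (hS.ratio_pos n).le
      (hS.ratio_lt_one hn)).const_mul (2 * jumpBound N β d P)
  obtain ⟨K, hK⟩ := (hlim.eventually_le_const hε).exists
  refine ⟨(Fin K × Fin (N - 1)) ⊕ Fin n, inferInstance, LinearMap.pi (Sum.elim
    (fun x => (iterPrimEval (n - 1) ((pieceMap a m)^[x.1] (breakpoint a (x.2 + 1)))).comp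
      (momentFree n).subtype)
    fun i => (iterPrimEval i ((pieceMap a m)^[K] 0)).comp (momentFree n).subtype), ?_⟩
  intro g hg h hh
  rw [LinearMap.mem_ker] at hg hh
  have b := hS.norm_inner_weightOp_sub_le hn K g h (fun i hi => congrFun hg (Sum.inr ⟨i, hi⟩))
    fun i hi => congrFun hh (Sum.inr ⟨i, hi⟩)
  rw [Finset.sum_eq_zero, sub_zero] at b
  · exact b.trans (by gcongr)
  · intro j hj
    refine Finset.sum_eq_zero fun k hk => ?_
    have h0 : iterPrim h.1 (n - 1) ((pieceMap a m)^[j] (breakpoint a (k + 1))) = 0 :=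
      congrFun hh (Sum.inl (⟨j, Finset.mem_range.1 hj⟩, ⟨k, Finset.mem_range.1 hk⟩))
    rw [conjProd, h0, mul_zero, mul_zero]

/-- Upper bound for the weight form on a subspace of controlled codimension. -/
theorem exists_codim_form_le {n : ℕ} (hn : 2 ≤ n) {Zp Zm : ℕ}
    (hZp : Nat.card {k : Fin (N - 1) // 0 < zetaCoeff N m β d (k + 1)} = Zp)
    (hZm : Nat.card {k : Fin (N - 1) // zetaCoeff N m β d (k + 1) < 0} = Zm) (k : ℕ) :
    ∃ (J : Type) (_ : Fintype J) (A : momentFree n →ₗ[ℂ] (J → ℂ)),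
      Fintype.card J ≤ k * (Zp + Zm) + n ∧ ∀ x ∈ LinearMap.ker A,
        (inner ℂ (weightOp n hn N β d P x) x).re ≤
          (2 * jumpBound N β d P + 1) * (a m ^ (2 * n - 1) * |d m|) ^ (2 * k) * ‖x‖ ^ 2 := by
  classical
  -- As `d m < 0`, signs alternate with the generation: `Zp` positive masses in an even one, `Zm` in
  -- an odd one, hence `Zp + Zm` in each consecutive pair.
  have hcard : ∀ K : ℕ, ∑ j ∈ Finset.range (2 * K), Nat.card
      {i : Fin (N - 1) // 0 < d m ^ j * zetaCoeff N m β d (i + 1)} = K * (Zp + Zm) := by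
    intro K
    induction K with
    | zero => simp
    | succ K ih =>
      rw [mul_add, mul_one, Finset.sum_range_succ, Finset.sum_range_succ, ih]
      have e1 : ∀ z : ℝ, 0 < d m ^ (2 * K) * z ↔ 0 < z := fun z => by
        rw [pow_mul]
        exact mul_pos_iff_of_pos_left (pow_pos (sq_pos_of_neg hS.d_neg) K)
      have e2 : ∀ z : ℝ, 0 < d m ^ (2 * K + 1) * z ↔ z < 0 := fun z => by
        rw [pow_succ, mul_assoc, e1]
        exact ⟨fun h => neg_of_mul_pos_right h hS.d_neg.le, fun h => mul_pos_of_neg_of_neg hS.d_neg h⟩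
      simp only [e1, e2, hZp, hZm]
      ring
  refine ⟨(Σ j : Fin (2 * k), {i : Fin (N - 1) // 0 < d m ^ (j : ℕ) * zetaCoeff N m β d (i + 1)})
    ⊕ Fin n, inferInstance, LinearMap.pi (Sum.elim
    (fun x => (iterPrimEval (n - 1) ((pieceMap a m)^[x.1] (breakpoint a (x.2.1 + 1)))).comp
      (momentFree n).subtype)
    fun i => (iterPrimEval i ((pieceMap a m)^[2 * k] 0)).comp (momentFree n).subtype), ?_, ?_⟩
  · rw [Fintype.card_sum, Fintype.card_sigma, Fintype.card_fin, ← hcard k]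
    simp only [← Nat.card_eq_fintype_card]
    rw [Fin.sum_univ_eq_sum_range (fun j => Nat.card
      {i : Fin (N - 1) // 0 < d m ^ j * zetaCoeff N m β d (i + 1)})]
  · intro g hg
    rw [LinearMap.mem_ker] at hg
    have hi : ∀ i < n, iterPrim g.1 i ((pieceMap a m)^[2 * k] 0) = 0 :=
      fun i hi => congrFun hg (Sum.inr ⟨i, hi⟩)
    have b := (Complex.re_le_norm _).trans (hS.norm_inner_weightOp_sub_le hn (2 * k) g g hi hi)
    rw [Complex.sub_re, Complex.re_sum] at b
    -- The positive masses have been killed, and the others only lower the form.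
    have hle : ∑ j ∈ Finset.range (2 * k), (∑ i ∈ Finset.range (N - 1),
        ((d m ^ j * zetaCoeff N m β d (i + 1) : ℝ) : ℂ) *
          conjProd n g.1 g.1 ((pieceMap a m)^[j] (breakpoint a (i + 1)))).re ≤ 0 := by
      refine Finset.sum_nonpos fun j hj => ?_
      rw [Complex.re_sum]
      refine Finset.sum_nonpos fun i hi => ?_
      by_cases hpos : 0 < d m ^ j * zetaCoeff N m β d (i + 1)
      · have h0 : iterPrim g.1 (n - 1) ((pieceMap a m)^[j] (breakpoint a (i + 1))) = 0 :=
          congrFun hg (Sum.inl ⟨⟨j, Finset.mem_range.1 hj⟩, ⟨⟨i, Finset.mem_range.1 hi⟩, hpos⟩⟩)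
        rw [conjProd, h0, mul_zero, mul_zero]
        simp
      · rw [conjProd, mul_comm (starRingEnd ℂ _), Complex.mul_conj, ← Complex.ofReal_mul,
          Complex.ofReal_re]
        exact mul_nonpos_of_nonpos_of_nonneg (not_lt.1 hpos) (Complex.normSq_nonneg _)
    have hq : 0 ≤ (a m ^ (2 * n - 1) * |d m|) ^ (2 * k) * ‖g‖ ^ 2 := by
      have := hS.ratio_pos n
      positivity
    nlinarith

end IsSimpleSelfSimilar

end
end

/-! ### The scaling operator, the bumps at the jumps, and the diagonalized form. -/

noncomputable section

theorem iteratedDeriv_comp_mul_sub (k : ℕ) (y : ℝ → ℂ) (c p : ℝ) :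
    iteratedDeriv k (fun x => y (c * (x - p))) =
      fun x => (c : ℂ) ^ k * iteratedDeriv k y (c * (x - p)) := by
  induction k with
  | zero => simp
  | succ k ih =>
    ext x
    rw [iteratedDeriv_succ, ih, deriv_const_mul_field]
    have h1 : deriv (fun x => iteratedDeriv k y (c * (x - p))) x =
        c • iteratedDeriv (k + 1) y (c * (x - p)) := by
      rw [deriv_comp_sub_const (f := fun t => iteratedDeriv k y (c * t)),
        deriv_comp_mul_left, iteratedDeriv_succ]
    rw [h1, Complex.real_smul]
    ring

theorem norm_sq_eq_integral_iteratedDeriv {n : ℕ} (hn : 2 ≤ n) (g : momentFree n) :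
    ‖g‖ ^ 2 = ∫ x, ‖iteratedDeriv n (sobolevEquiv n hn g).1 x‖ ^ 2 := by
  rw [Submodule.coe_norm, norm_sq_eq_integral_zeroExt, sobolevEquiv_apply]
  refine integral_congr_ae ?_
  filter_upwards [iteratedDeriv_iterPrim_ae hn g.1] with x hx
  rw [hx]

theorem contDiff_mem_sobolevZero {n : ℕ} (hn : 1 ≤ n) {y : ℝ → ℂ} (hy : ContDiff ℝ n y)
    (h0 : ∀ x ∉ Ioo (0 : ℝ) 1, y x = 0) (hd : iteratedDeriv (n - 1) y 0 = 0) :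
    y ∈ sobolevZero n := by
  have hc : Continuous (iteratedDeriv n y) := hy.continuous_iteratedDeriv n le_rfl
  refine ⟨h0, hy.of_le (by exact_mod_cast Nat.sub_le n 1), iteratedDeriv n y, ?_, fun x hx => ?_⟩
  · obtain ⟨C, hC⟩ := isCompact_Icc.exists_bound_of_continuousOn (s := Icc (0 : ℝ) 1)
      hc.continuousOn
    refine MemLp.of_bound hc.aestronglyMeasurable C ?_
    filter_upwards [ae_restrict_mem measurableSet_Icc] with t ht using hC t ht
  · have hder : ∀ t, HasDerivAt (iteratedDeriv (n - 1) y) (iteratedDeriv n y t) t := by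
      intro t
      have hdiff : Differentiable ℝ (iteratedDeriv (n - 1) y) :=
        hy.differentiable_iteratedDeriv _ (by exact_mod_cast (by omega))
      have := (hdiff t).hasDerivAt
      rwa [← iteratedDeriv_succ, Nat.sub_add_cancel hn] at this
    rw [intervalIntegral.integral_eq_sub_of_hasDerivAt (fun t _ => hder t)
      (hc.intervalIntegrable _ _), hd, sub_zero]

section

variable {N m : ℕ} {a β d : ℕ → ℝ} {P : Lp ℝ 2 unitMeasure}

namespace IsSimpleSelfSimilar

variable (hS : IsSimpleSelfSimilar N m a β d P)
include hS

theorem breakpoint_m : breakpoint a m = breakpoint a (m - 1) + a m := by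
  have hm := (Finset.mem_Icc.1 hS.m_mem).1
  have := breakpoint_succ (a := a) (m - 1)
  rwa [Nat.sub_add_cancel hm] at this

theorem pieceMap_mem_Ioo {x : ℝ} (hx : x ∈ Ioo (0 : ℝ) 1) :
    pieceMap a m x ∈ Ioo (breakpoint a (m - 1)) (breakpoint a m) := by
  have h0 := hS.a_m_pos
  rw [hS.breakpoint_m]
  unfold pieceMap
  constructor <;> nlinarith [hx.1, hx.2]

theorem pieceMap_mem_Icc {x : ℝ} (hx : x ∈ Icc (0 : ℝ) 1) :
    pieceMap a m x ∈ Icc (breakpoint a (m - 1)) (breakpoint a m) := by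
  have h0 := hS.a_m_pos
  rw [hS.breakpoint_m]
  unfold pieceMap
  constructor <;> nlinarith [hx.1, hx.2]

theorem breakpoint_notMem_Ioo {k : ℕ} (hk : k ≤ N) :
    breakpoint a k ∉ Ioo (breakpoint a (m - 1)) (breakpoint a m) := by
  have hm := Finset.mem_Icc.1 hS.m_mem
  rintro ⟨h1, h2⟩
  rcases Nat.lt_or_ge k m with h | h
  · have := hS.breakpoint_mono (show k ≤ m - 1 by omega) (by omega)
    linarith
  · have := hS.breakpoint_mono h hk
    linarith

theorem breakpoint_mem_Ioo {k : ℕ} (hk1 : 1 ≤ k) (hk : k < N) :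
    breakpoint a k ∈ Ioo (0 : ℝ) 1 := by
  rw [← breakpoint_zero (a := a), ← hS.breakpoint_last]
  exact ⟨hS.breakpoint_strictMono hk1 hk.le, hS.breakpoint_strictMono hk le_rfl⟩

/-- No breakpoint is interior to the `m`-th interval, so equality would force `pieceMap a m x` to be
`0` or `1`, and then the breakpoint to be that same end of `[0, 1]`. Hence a bump at `α_k` can avoid
the second generation interval even when `α_k` bounds the `m`-th interval. -/
theorem breakpoint_ne_pieceMap_pieceMap {k : ℕ} (hk1 : 1 ≤ k) (hk : k < N) {x : ℝ}
    (hx : x ∈ Icc (0 : ℝ) 1) : breakpoint a k ≠ pieceMap a m (pieceMap a m x) := by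
  have hm := Finset.mem_Icc.1 hS.m_mem
  have h0 := hS.a_m_pos
  intro heq
  have h1 := hS.pieceMap_mem_Icc hx
  have hb1 := hS.breakpoint_mem (show m - 1 ≤ N by omega)
  have hb2 := hS.breakpoint_mem hm.2
  have hsub : pieceMap a m x ∉ Ioo (0 : ℝ) 1 := fun h =>
    hS.breakpoint_notMem_Ioo hk.le (heq ▸ hS.pieceMap_mem_Ioo h)
  have hval : breakpoint a k = breakpoint a (m - 1) + a m * pieceMap a m x := heq
  rcases le_or_gt (pieceMap a m x) 0 with hle | hgt
  · have hz : pieceMap a m x = 0 := le_antisymm hle (hb1.1.trans h1.1)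
    rw [hz, mul_zero, add_zero] at hval
    have h2 := (hS.breakpoint_mem_Ioo hk1 hk).1
    linarith [h1.1]
  · have hz : pieceMap a m x = 1 := le_antisymm (h1.2.trans hb2.2)
      (not_lt.1 fun h => hsub ⟨hgt, h⟩)
    rw [hz, mul_one, ← hS.breakpoint_m] at hval
    have h2 := (hS.breakpoint_mem_Ioo hk1 hk).2
    linarith [h1.2]

theorem shrink_notMem {x : ℝ} (hx : x ∉ Ioo (breakpoint a (m - 1)) (breakpoint a m)) :
    (a m)⁻¹ * (x - breakpoint a (m - 1)) ∉ Ioo (0 : ℝ) 1 := by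
  have h0 := hS.a_m_pos
  intro h
  refine hx ?_
  have := hS.pieceMap_mem_Ioo h
  unfold pieceMap at this
  rwa [mul_inv_cancel_left₀ h0.ne', add_sub_cancel] at this

/-- Since `y` is already `C^(n-1)` on the line when extended by zero, no matching conditions arise
at the ends of the `m`-th interval. -/
theorem comp_shrink_mem {n : ℕ} (hn : 2 ≤ n) {y : ℝ → ℂ} (hy : y ∈ sobolevZero n) :
    (fun x => y ((a m)⁻¹ * (x - breakpoint a (m - 1)))) ∈ sobolevZero n := by
  have h0 := hS.a_m_pos
  have hm := Finset.mem_Icc.1 hS.m_mem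
  set c := (a m)⁻¹ with hc
  set p := breakpoint a (m - 1) with hp
  have hc0 : 0 < c := inv_pos.2 h0
  have hp0 : 0 ≤ p := (hS.breakpoint_mem (show m - 1 ≤ N by omega)).1
  obtain ⟨G, hG, hGy⟩ := exists_iterPrim_eq (by omega) hy
  refine ⟨fun x hx => hy.1 _ (hS.shrink_notMem fun h => hx ?_), hy.2.1.comp (by fun_prop),
    fun x => (c : ℂ) ^ n * zeroExt G (c * (x - p)), ?_, fun x hx => ?_⟩
  · exact ⟨(hS.breakpoint_mem (show m - 1 ≤ N by omega)).1.trans_lt h.1,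
      h.2.trans_le (hS.breakpoint_mem hm.2).2⟩
  · refine MemLp.const_mul (f := fun x => zeroExt G (c * (x - p))) ?_ _
    have hmeas : AEStronglyMeasurable (fun x => zeroExt G (c * (x - p))) volume :=
      ((stronglyMeasurable_zeroExt G).comp_measurable (by fun_prop)).aestronglyMeasurable
    refine MemLp.restrict _ ((memLp_two_iff_integrable_sq_norm hmeas).2 ?_)
    have h1 : Integrable fun x => ‖zeroExt G x‖ ^ 2 :=
      (memLp_zeroExt G).integrable_norm_pow two_ne_zero
    exact (h1.comp_mul_left' hc0.ne').comp_sub_right p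
  · have h2 : iteratedDeriv (n - 1) y = iterPrim G 0 := by
      have := iteratedDeriv_iterPrim G (n - 1) 0
      rwa [zero_add, hGy] at this
    rw [iteratedDeriv_comp_mul_sub, h2]
    have h3 : ∀ t, c * (t - p) = c * t - c * p := fun t => by ring
    simp only [h3]
    rw [intervalIntegral.integral_const_mul,
      intervalIntegral.integral_comp_mul_sub (fun t => zeroExt G t) hc0.ne']
    have h4 : iterPrim G 0 (c * x - c * p) - iterPrim G 0 (c * 0 - c * p) =
        ∫ t in c * 0 - c * p..c * x - c * p, zeroExt G t :=
      intervalIntegral.integral_interval_sub_left (integrable_zeroExt G).intervalIntegrable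
        (integrable_zeroExt G).intervalIntegrable
    rw [iterPrim_eq_zero_of_nonpos G 0 (x := c * 0 - c * p) (by nlinarith), sub_zero] at h4
    rw [← h4, Complex.real_smul, ← mul_assoc]
    congr 1
    have hc1 : (c : ℂ) ≠ 0 := by exact_mod_cast hc0.ne'
    obtain ⟨r, rfl⟩ : ∃ r, n = r + 1 := ⟨n - 1, by omega⟩
    push_cast
    rw [pow_succ, mul_assoc, mul_inv_cancel₀ hc1, mul_one]

/-- Composition with the inverse of the contraction onto the `m`-th interval. -/
def shrink {n : ℕ} (hn : 2 ≤ n) : sobolevZero n →ₗ[ℂ] sobolevZero n where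
  toFun y := ⟨_, hS.comp_shrink_mem hn y.2⟩
  map_add' _ _ := rfl
  map_smul' _ _ := rfl

/-- The operator `shrink` in terms of `n`-th derivatives. -/
def shrinkOp {n : ℕ} (hn : 2 ≤ n) : momentFree n →ₗ[ℂ] momentFree n :=
  ((sobolevEquiv n hn).symm : sobolevZero n →ₗ[ℂ] momentFree n).comp
    ((hS.shrink hn).comp (sobolevEquiv n hn : momentFree n →ₗ[ℂ] sobolevZero n))

theorem sobolevEquiv_shrinkOp {n : ℕ} (hn : 2 ≤ n) (w : momentFree n) :
    (sobolevEquiv n hn (hS.shrinkOp hn w)).1 =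
      fun x => (sobolevEquiv n hn w).1 ((a m)⁻¹ * (x - breakpoint a (m - 1))) := by
  simp only [shrinkOp, LinearMap.comp_apply, LinearEquiv.coe_coe, LinearEquiv.apply_symm_apply]
  rfl

/-- Differentiating `n` times gives `a_m^(-2n)` in the square; the change of variables returns one
`a_m`. -/
theorem norm_shrinkOp_sq {n : ℕ} (hn : 2 ≤ n) (w : momentFree n) :
    ‖hS.shrinkOp hn w‖ ^ 2 = (a m ^ (2 * n - 1))⁻¹ * ‖w‖ ^ 2 := by
  have h0 := hS.a_m_pos
  rw [norm_sq_eq_integral_iteratedDeriv hn, hS.sobolevEquiv_shrinkOp,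
    norm_sq_eq_integral_iteratedDeriv hn w, iteratedDeriv_comp_mul_sub]
  simp only [norm_mul, mul_pow]
  rw [integral_const_mul, integral_sub_right_eq_self
    (fun x => ‖iteratedDeriv n (sobolevEquiv n hn w).1 ((a m)⁻¹ * x)‖ ^ 2),
    Measure.integral_comp_mul_left
    (fun x => ‖iteratedDeriv n (sobolevEquiv n hn w).1 x‖ ^ 2), smul_eq_mul, ← mul_assoc]
  congr 1
  rw [norm_pow, Complex.norm_real, inv_inv, Real.norm_of_nonneg (inv_pos.2 h0).le, abs_of_pos h0]
  obtain ⟨r, hr⟩ : ∃ r, 2 * n = r + 1 := ⟨2 * n - 1, by omega⟩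
  rw [← pow_mul, mul_comm n 2, hr, Nat.add_sub_cancel, inv_pow, pow_succ]
  field_simp

/-- Smooth functions supported near one jump point. -/
theorem exists_bump {n : ℕ} (hn : 2 ≤ n) {k : ℕ} (hk1 : 1 ≤ k) (hk : k < N) :
    ∃ φ ∈ sobolevZero n, φ (breakpoint a k) = 1 ∧ (∀ j ≤ N, j ≠ k → φ (breakpoint a j) = 0) ∧
      (∀ j, 1 ≤ j → j < N → φ (pieceMap a m (breakpoint a j)) = 0) ∧
      ∀ x ∈ Icc (0 : ℝ) 1, φ (pieceMap a m (pieceMap a m x)) = 0 := by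
  have hcont : Continuous (pieceMap a m) := by unfold pieceMap; fun_prop
  -- `F` collects where the bump must vanish: outside `(0, 1)`, at the other breakpoints, at their
  -- images of the next generation, and on the interval containing all later generations.
  set F : Set ℝ := (Ioo (0 : ℝ) 1)ᶜ ∪ ((breakpoint a '' {j | j ≤ N ∧ j ≠ k}) ∪
    ((fun j => pieceMap a m (breakpoint a j)) '' {j | 1 ≤ j ∧ j < N} ∪
      (fun x => pieceMap a m (pieceMap a m x)) '' Icc (0 : ℝ) 1)) with hF
  have hfin1 : {j | j ≤ N ∧ j ≠ k}.Finite := (finite_Iic N).subset fun j hj => hj.1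
  have hfin2 : {j | 1 ≤ j ∧ j < N}.Finite := (finite_Iic N).subset fun j hj => hj.2.le
  have hclosed : IsClosed F := by
    refine isOpen_Ioo.isClosed_compl.union ((hfin1.image _).isClosed.union
      ((hfin2.image _).isClosed.union ?_))
    exact (isCompact_Icc.image (hcont.comp hcont)).isClosed
  have hnot : breakpoint a k ∉ F := by
    rintro (h | ⟨j, ⟨hj, hjk⟩, h⟩ | ⟨j, ⟨hj1, hj2⟩, h⟩ | ⟨x, hx, h⟩)
    · exact h (hS.breakpoint_mem_Ioo hk1 hk)
    · rcases lt_or_gt_of_ne hjk with hlt | hlt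
      · exact (hS.breakpoint_strictMono hlt hk.le).ne h
      · exact (hS.breakpoint_strictMono hlt hj).ne' h
    · exact hS.breakpoint_notMem_Ioo hk.le (h ▸ hS.pieceMap_mem_Ioo (hS.breakpoint_mem_Ioo hj1 hj2))
    · exact hS.breakpoint_ne_pieceMap_pieceMap hk1 hk hx h.symm
  obtain ⟨f, hfs, -, hfc, -, hf1⟩ := exists_contDiff_tsupport_subset (n := n)
    (hclosed.isOpen_compl.mem_nhds hnot)
  have hfF : ∀ x ∈ F, f x = 0 := fun x hx => image_eq_zero_of_notMem_tsupport fun h => hfs h hx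
  refine ⟨fun x => (f x : ℂ), contDiff_mem_sobolevZero (by omega)
    (Complex.ofRealCLM.contDiff.comp hfc) (fun x hx => by simp [hfF x (Or.inl hx)]) ?_,
    by simp [hf1], fun j hj hjk => ?_, fun j hj1 hj2 => ?_, fun x hx => ?_⟩
  · have h0 : (0 : ℝ) ∈ (tsupport f)ᶜ := fun h => hfs h (Or.inl (by simp))
    have : (fun x => (f x : ℂ)) =ᶠ[𝓝 0] fun _ => (0 : ℂ) := by
      filter_upwards [(isClosed_tsupport f).isOpen_compl.mem_nhds h0] with t ht
      simp [image_eq_zero_of_notMem_tsupport ht]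
    rw [this.iteratedDeriv_eq]
    simp
  · simp [hfF _ (Or.inr (Or.inl ⟨j, ⟨hj, hjk⟩, rfl⟩))]
  · simp [hfF _ (Or.inr (Or.inr (Or.inl ⟨j, ⟨hj1, hj2⟩, rfl⟩)))]
  · simp [hfF _ (Or.inr (Or.inr (Or.inr ⟨x, hx, rfl⟩)))]

/-- Serves to discard the cross terms in `exists_diagonalizing`. -/
theorem jumpForm_eq_zero_of_vanishing {e : ℝ → ℂ} (he : ContDiff ℝ 1 e)
    (h1 : ∀ j, 1 ≤ j → j < N → e (breakpoint a j) = 0)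
    (h2 : ∀ x ∈ Icc (0 : ℝ) 1, e (pieceMap a m x) = 0) : jumpForm N β d P e = 0 := by
  rw [hS.jumpForm_eq he, jumpForm_eq_zero (f := e ∘ pieceMap a m) h2, mul_zero, add_zero]
  refine Finset.sum_eq_zero fun k hk => ?_
  rw [h1 (k + 1) (by omega) (by have := Finset.mem_range.1 hk; omega), mul_zero]

/-- Finitely many vectors which together with the range of `shrinkOp` diagonalize the form. -/
theorem exists_diagonalizing {n : ℕ} (hn : 2 ≤ n) :
    ∃ Φ : (Fin (N - 1) → ℂ) →ₗ[ℂ] momentFree n, ∀ w c,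
      (inner ℂ (weightOp n hn N β d P (hS.shrinkOp hn w + Φ c)) (hS.shrinkOp hn w + Φ c)).re =
        d m * (inner ℂ (weightOp n hn N β d P w) w).re +
          ∑ k : Fin (N - 1), zetaCoeff N m β d (k + 1) * ‖c k‖ ^ 2 := by
  have hm := Finset.mem_Icc.1 hS.m_mem
  have hbump : ∀ k : Fin (N - 1), ∃ φ : sobolevZero n, φ.1 (breakpoint a (k + 1)) = 1 ∧
      (∀ j ≤ N, j ≠ (k : ℕ) + 1 → φ.1 (breakpoint a j) = 0) ∧
      (∀ j, 1 ≤ j → j < N → φ.1 (pieceMap a m (breakpoint a j)) = 0) ∧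
      ∀ x ∈ Icc (0 : ℝ) 1, φ.1 (pieceMap a m (pieceMap a m x)) = 0 := fun k => by
    obtain ⟨φ, h1, h2⟩ := hS.exists_bump hn (k := k + 1) (by omega) (by omega)
    exact ⟨⟨φ, h1⟩, h2⟩
  choose φ hφ1 hφ2 hφ3 hφ4 using hbump
  refine ⟨((sobolevEquiv n hn).symm : sobolevZero n →ₗ[ℂ] momentFree n).comp
    (Fintype.linearCombination ℂ φ), fun w c => ?_⟩
  set Φ := ((sobolevEquiv n hn).symm : sobolevZero n →ₗ[ℂ] momentFree n).comp
    (Fintype.linearCombination ℂ φ) with hΦ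
  set u := hS.shrinkOp hn w + Φ c with hu
  set Y : ℝ → ℂ := iterPrim w.1 (n - 1) with hY
  set B : ℝ → ℂ := fun x => ∑ k, c k * (φ k).1 x with hB
  have hYw : Y = (sobolevEquiv n hn w).1 := rfl
  have hy : iterPrim u.1 (n - 1) =
      fun x => Y ((a m)⁻¹ * (x - breakpoint a (m - 1))) + B x := by
    rw [← sobolevEquiv_apply hn, hu, map_add]
    ext x
    have e1 := congrFun (hS.sobolevEquiv_shrinkOp hn w) x
    have e2 : (sobolevEquiv n hn (Φ c)).1 x = B x := by
      simp only [hΦ, LinearMap.comp_apply, LinearEquiv.coe_coe, LinearEquiv.apply_symm_apply,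
        Fintype.linearCombination_apply, hB]
      simp
    rw [Submodule.coe_add, Pi.add_apply, e1, e2, ← hYw]
  have hYc : ContDiff ℝ 1 Y := contDiff_one_iterPrim hn w.1
  have hBc : ContDiff ℝ 1 B := ContDiff.sum fun k _ =>
    contDiff_const.mul (sobolevZero_contDiff hn (φ k).2)
  have hpc : ContDiff ℝ 1 (pieceMap a m) := by unfold pieceMap; fun_prop
  have hBbp : ∀ k : Fin (N - 1), B (breakpoint a (k + 1)) = c k := by
    intro k
    simp only [hB]
    rw [Finset.sum_eq_single k]
    · rw [hφ1, mul_one]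
    · intro j _ hjk
      rw [hφ2 j (k + 1) (by omega) (fun h => hjk (Fin.ext (by omega))), mul_zero]
    · exact fun h => absurd (Finset.mem_univ k) h
  -- The shrunken function vanishes at every breakpoint, because none lies inside the open `m`-th
  -- interval; only the bumps are seen there.
  have hval : ∀ k : Fin (N - 1), iterPrim u.1 (n - 1) (breakpoint a (k + 1)) = c k := by
    intro k
    rw [hy]
    dsimp only
    rw [hBbp, hYw, (sobolevEquiv n hn w).2.1 _
      (hS.shrink_notMem (hS.breakpoint_notMem_Ioo (by omega))), zero_add]
  have hcomp : ∀ x, iterPrim u.1 (n - 1) (pieceMap a m x) = Y x + B (pieceMap a m x) := by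
    intro x
    rw [hy]
    dsimp only
    congr 2
    unfold pieceMap
    rw [add_sub_cancel_left, inv_mul_cancel_left₀ hS.a_m_pos.ne']
  set ψ : ℝ → ℂ := fun x => B (pieceMap a m x) with hψ
  have hψc : ContDiff ℝ 1 ψ := hBc.comp hpc
  -- `e` collects the terms involving the bumps inside the `m`-th interval. A bump at an end of that
  -- interval overlaps the shrunken function, but `e` vanishes wherever the rescaled weight has its
  -- masses.
  set e : ℝ → ℂ := fun x => starRingEnd ℂ (Y x) * ψ x + starRingEnd ℂ (ψ x) * Y x +
    starRingEnd ℂ (ψ x) * ψ x with he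
  have hec : ContDiff ℝ 1 e :=
    (((Complex.conjCLE.contDiff.comp hYc).mul hψc).add
      ((Complex.conjCLE.contDiff.comp hψc).mul hYc)).add
      ((Complex.conjCLE.contDiff.comp hψc).mul hψc)
  have hez : ∀ x, ψ x = 0 → e x = 0 := fun x hx => by simp [he, hx]
  have hdec : conjProd n u.1 u.1 ∘ pieceMap a m = conjProd n w.1 w.1 + e := by
    ext x
    simp only [Function.comp, conjProd, hcomp, Pi.add_apply, he, map_add, ← hY]
    ring
  have he0 : jumpForm N β d P e = 0 := by
    refine hS.jumpForm_eq_zero_of_vanishing hec (fun j hj1 hj2 => hez _ ?_) fun x hx => hez _ ?_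
    · exact Finset.sum_eq_zero fun k _ => by rw [hφ3 k j hj1 hj2, mul_zero]
    · exact Finset.sum_eq_zero fun k _ => by rw [hφ4 k x hx, mul_zero]
  rw [inner_weightOp, inner_weightOp, hS.jumpForm_eq (contDiff_conjProd hn _ _), hdec,
    jumpForm_add (contDiff_conjProd hn _ _) hec, he0, add_zero, Complex.add_re,
    Complex.re_ofReal_mul, add_comm]
  congr 1
  rw [Finset.sum_range (fun k => (zetaCoeff N m β d (k + 1) : ℂ) *
    conjProd n u.1 u.1 (breakpoint a (k + 1))), Complex.re_sum]
  refine Finset.sum_congr rfl fun k _ => ?_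
  rw [conjProd, hval, mul_comm (starRingEnd ℂ _), Complex.mul_conj, Complex.re_ofReal_mul,
    Complex.ofReal_re, Complex.normSq_eq_norm_sq]

end IsSimpleSelfSimilar

end
end

/-! ### Return to the boundary value problem. -/

noncomputable section

section

variable {N m : ℕ} {a β d : ℕ → ℝ} {P : Lp ℝ 2 unitMeasure}

/-- The product of the two functions vanishes at `0` and `1`, so the boundary terms of `jumpForm`
drop out and `-∫ P (y z̄)'` remains. -/
theorem pencilForm_sobolevEquiv {n : ℕ} (hn : 2 ≤ n) (lam : ℂ) (g h : momentFree n) :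
    pencilForm n P lam (sobolevEquiv n hn g).1 (sobolevEquiv n hn h).1 =
      inner ℂ h (g - lam • weightOp n hn N β d P g) := by
  have hg := (sobolevEquiv n hn g).2
  have hh := (sobolevEquiv n hn h).2
  have hfun : (fun t => (sobolevEquiv n hn g).1 t * starRingEnd ℂ ((sobolevEquiv n hn h).1 t)) =
      conjProd n h.1 g.1 := by
    ext t
    rw [sobolevEquiv_apply, sobolevEquiv_apply, conjProd, mul_comm]
  have hcp := contDiff_conjProd hn h.1 g.1
  have hi1 : Integrable (fun x => iteratedDeriv n (sobolevEquiv n hn g).1 x *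
      starRingEnd ℂ (iteratedDeriv n (sobolevEquiv n hn h).1 x)) unitMeasure :=
    (sobolevZero_memLp hn hg).integrable_mul (sobolevZero_memLp hn hh).star
  have hJ : jumpForm N β d P (conjProd n h.1 g.1) =
      -∫ x in Icc (0 : ℝ) 1, ((P x : ℝ) : ℂ) * deriv (conjProd n h.1 g.1) x := by
    have e0 : conjProd n h.1 g.1 0 = 0 := by simp [conjProd, iterPrim_zero]
    have e1 : conjProd n h.1 g.1 1 = 0 := by
      rw [conjProd, mem_momentFree.1 g.2 (n - 1) (by omega), mul_zero]
    rw [jumpForm, e0, e1]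
    ring
  have hsym : inner ℂ h (weightOp n hn N β d P g) = inner ℂ (weightOp n hn N β d P h) g :=
    (weightOp_isSymmetric (N := N) (β := β) (d := d) (P := P) hn h g).symm
  have hin : inner ℂ h g = ∫ x in Icc (0 : ℝ) 1, iteratedDeriv n (sobolevEquiv n hn g).1 x *
      starRingEnd ℂ (iteratedDeriv n (sobolevEquiv n hn h).1 x) := by
    rw [Submodule.coe_inner, L2.inner_def]
    refine integral_congr_ae ?_
    filter_upwards [ae_restrict_of_ae (iteratedDeriv_iterPrim_ae hn g.1), zeroExt_ae g.1,
      ae_restrict_of_ae (iteratedDeriv_iterPrim_ae hn h.1), zeroExt_ae h.1] with x h1 h2 h3 h4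
    rw [sobolevEquiv_apply, sobolevEquiv_apply, h1, h2, h3, h4, RCLike.inner_apply]
  have hsm : inner ℂ h (lam • weightOp n hn N β d P g) =
      lam * inner ℂ h (weightOp n hn N β d P g) := inner_smul_right h _ lam
  rw [inner_sub_right, hsm, hsym, inner_weightOp, hJ, hin, pencilForm, hfun,
    mul_neg, sub_neg_eq_add, ← integral_const_mul,
    ← integral_add hi1 ((integrable_Lp_mul_deriv P hcp).const_mul lam)]
  simp only [mul_assoc]

theorem eigenspaceOf_eq_map {n : ℕ} (hn : 2 ≤ n) {lam : ℂ} (hlam : lam ≠ 0) :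
    eigenspaceOf n hn P lam =
      (Module.End.eigenspace (weightOp n hn N β d P : Module.End ℂ (momentFree n)) lam⁻¹).map
        ((sobolevZero n).subtype.comp
          (sobolevEquiv n hn : momentFree n →ₗ[ℂ] sobolevZero n)) := by
  have key : ∀ g : momentFree n, (∀ z ∈ sobolevZero n,
      pencilForm n P lam (sobolevEquiv n hn g).1 z = 0) ↔
        weightOp n hn N β d P g = lam⁻¹ • g := by
    intro g
    rw [eq_inv_smul_iff₀ hlam]
    constructor
    · intro hz
      have : g - lam • weightOp n hn N β d P g = 0 := by
        refine ext_inner_left ℂ fun h => ?_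
        rw [← pencilForm_sobolevEquiv, hz _ (sobolevEquiv n hn h).2, inner_zero_right]
      exact (sub_eq_zero.1 this).symm
    · intro hg z hz
      obtain ⟨h, hh⟩ := (sobolevEquiv n hn).surjective ⟨z, hz⟩
      have := pencilForm_sobolevEquiv (N := N) (β := β) (d := d) (P := P) hn lam g h
      rw [hg, sub_self, inner_zero_right, hh] at this
      exact this
  ext y
  rw [Submodule.mem_map]
  constructor
  · rintro ⟨hy, hz⟩
    obtain ⟨g, hg⟩ := (sobolevEquiv n hn).surjective ⟨y, hy⟩
    have hg' : (sobolevEquiv n hn g).1 = y := congrArg Subtype.val hg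
    refine ⟨g, Module.End.mem_eigenspace_iff.2 ((key g).1 ?_), hg'⟩
    rwa [hg']
  · rintro ⟨g, hg, rfl⟩
    exact ⟨(sobolevEquiv n hn g).2, (key g).2 (Module.End.mem_eigenspace_iff.1 hg)⟩

theorem eigenMult_eq {n : ℕ} (hn : 2 ≤ n) {t : ℝ} (ht : t ≠ 0)
    (hfd : FiniteDimensional ℂ (Module.End.eigenspace
      (weightOp n hn N β d P : Module.End ℂ (momentFree n)) ((t⁻¹ : ℝ) : ℂ))) :
    eigenMult n hn P t = Module.finrank ℂ (Module.End.eigenspace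
      (weightOp n hn N β d P : Module.End ℂ (momentFree n)) ((t⁻¹ : ℝ) : ℂ)) := by
  have hinj : Function.Injective ((sobolevZero n).subtype.comp
      (sobolevEquiv n hn : momentFree n →ₗ[ℂ] sobolevZero n)) :=
    Subtype.val_injective.comp (sobolevEquiv n hn).injective
  rw [eigenMult, eigenspaceOf_eq_map (N := N) (β := β) (d := d) hn (Complex.ofReal_ne_zero.2 ht),
    ← (Submodule.equivMapOfInjective _ hinj _).rank_eq, ← Complex.ofReal_inv,
    ← Module.finrank_eq_rank, Cardinal.toENat_nat]

theorem eigenspace_neg {E : Type*} [AddCommGroup E] [Module ℂ E] (T : Module.End ℂ E) (μ : ℂ) :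
    Module.End.eigenspace (-T) μ = Module.End.eigenspace T (-μ) := by
  ext x
  rw [Module.End.mem_eigenspace_iff, Module.End.mem_eigenspace_iff, LinearMap.neg_apply,
    neg_smul, neg_eq_iff_eq_neg]

end

/-! ### Two-sided numbering and assembly of the result. -/

theorem card_filter_Icc_eq (p : ℕ → Prop) [DecidablePred p] (M : ℕ) :
    Nat.card {k : Fin M // p (k + 1)} = {k ∈ Finset.Icc 1 M | p k}.card := by
  rw [Nat.card_eq_fintype_card, Fintype.card_subtype]
  refine Finset.card_bij (fun k _ => (k : ℕ) + 1) (fun k hk => ?_) (fun j _ k _ h => ?_)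
    fun k hk => ?_
  · rw [Finset.mem_filter, Finset.mem_Icc]
    exact ⟨⟨by omega, by omega⟩, (Finset.mem_filter.1 hk).2⟩
  · exact Fin.ext (by omega)
  · rw [Finset.mem_filter, Finset.mem_Icc] at hk
    refine ⟨⟨k - 1, by omega⟩, Finset.mem_filter.2 ⟨Finset.mem_univ _, ?_⟩, ?_⟩
    · simpa [Nat.sub_add_cancel hk.1.1] using hk.2
    · simp [Nat.sub_add_cancel hk.1.1]

/-- Combine two sequences into one indexed by the non-zero integers. -/
def twoSided (Lp Lm : ℕ → ℝ) (k : ℤ) : ℝ :=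
  if 0 < k then Lp (k - 1).toNat else if k < 0 then -Lm (-k - 1).toNat else 0

theorem twoSided_succ (Lp Lm : ℕ → ℝ) (j : ℕ) : twoSided Lp Lm ((j : ℤ) + 1) = Lp j := by
  rw [twoSided, if_pos (by omega)]
  congr 1
  omega

theorem twoSided_neg_succ (Lp Lm : ℕ → ℝ) (j : ℕ) :
    twoSided Lp Lm (-((j : ℤ) + 1)) = -Lm j := by
  rw [twoSided, if_neg (by omega), if_pos (by omega)]
  congr 2
  omega

theorem isEquivalent_of_tendsto_mul {u : ℕ → ℝ} {q τ : ℝ} (hq : 0 < q) (hτ : τ ≠ 0) (e : ℕ → ℤ)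
    (h : Tendsto (fun k => u k * q ^ e k) atTop (𝓝 τ)) :
    u ~[atTop] fun k => τ * q ^ (-e k) := by
  have hne : ∀ k, τ * q ^ (-e k) ≠ 0 := fun k => mul_ne_zero hτ (zpow_pos hq _).ne'
  refine (isEquivalent_iff_tendsto_one (Eventually.of_forall hne)).2 ?_
  have h1 := h.div_const τ
  rw [div_self hτ] at h1
  refine h1.congr fun k => ?_
  have := (zpow_pos hq (e k)).ne'
  simp only [Pi.div_apply, zpow_neg]
  field_simp
end

theorem mainTheorem3
    (n : ℕ) (hn : 2 ≤ n) (N : ℕ) (hN : 2 ≤ N) (a β d : ℕ → ℝ)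
    (ha : ∀ k ∈ Finset.Icc 1 N, 0 < a k)
    (hsum : ∑ k ∈ Finset.Icc 1 N, a k = 1)
    (hcontr : ∑ k ∈ Finset.Icc 1 N, a k * |d k| ^ 2 < 1)
    (m : ℕ) (hm : m ∈ Finset.Icc 1 N)
    (hd : ∀ k ∈ Finset.Icc 1 N, k ≠ m → d k = 0)
    (hdm : d m < 0)
    (hZ : numPos N m β d + numNeg N m β d = N - 1)
    (P : Lp ℝ 2 unitMeasure)
    (hP : (P : ℝ → ℝ) =ᵐ[unitMeasure] similarityOp N a β d P) :
    ∃ ev : ℤ → ℝ, IsEigenvalueNumbering n hn P ev ∧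
      ∃ τ : ℕ → ℝ, ∀ l ∈ Finset.Icc 1 (N - 1), 0 < τ l ∧
        ((fun k : ℕ => ev ((l : ℤ) + k * ((N : ℤ) - 1))) ~[atTop]
          fun k : ℕ => τ l * (a m ^ (2 * n - 1) * |d m|) ^ (-2 * (k : ℤ))) ∧
        ((fun k : ℕ => ev (-((l : ℤ) + numNeg N m β d + k * ((N : ℤ) - 1)))) ~[atTop]
          fun k : ℕ => -τ l * (a m ^ (2 * n - 1) * |d m|) ^ (-2 * (k : ℤ) - 1)) := by
  have hS : IsSimpleSelfSimilar N m a β d P := ⟨hN, ha, hsum, hcontr, hm, hd, hdm, hP⟩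
  set q := a m ^ (2 * n - 1) * |d m| with hq
  have hq0 : 0 < q := hS.ratio_pos n
  have hZp : Nat.card {k : Fin (N - 1) // 0 < zetaCoeff N m β d (k + 1)} = numPos N m β d :=
    card_filter_Icc_eq (fun k => 0 < zetaCoeff N m β d k) (N - 1)
  have hZm : Nat.card {k : Fin (N - 1) // zetaCoeff N m β d (k + 1) < 0} = numNeg N m β d :=
    card_filter_Icc_eq (fun k => zetaCoeff N m β d k < 0) (N - 1)
  obtain ⟨Φ, hΦ⟩ := hS.exists_diagonalizing hn
  have hT := hS.weightOp_hasSmallTails hn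
  have hTs := weightOp_isSymmetric (N := N) (β := β) (d := d) (P := P) hn
  obtain ⟨Lp, Lm, ⟨hpm, hp0, hpe⟩, ⟨hmm, hm0, hme⟩, hlim⟩ :=
    exists_charValues_asymptotics hT hTs (hS.shrinkOp hn) Φ
      (fun k : Fin (N - 1) => zetaCoeff N m β d (k + 1)) (s := (a m ^ (2 * n - 1))⁻¹) (d := d m)
      (q := q) (n := n) (inv_pos.2 (pow_pos hS.a_m_pos _)) hdm
      (by rw [hq, abs_of_neg hdm, div_inv_eq_mul, mul_comm]) (hS.ratio_lt_one hn)
      (hS.norm_shrinkOp_sq hn) hΦ hZp hZm hZ (by omega)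
      (B := 2 * jumpBound N β d P + 1)
      (by have := jumpBound_nonneg (N := N) (β := β) (d := d) (P := P); positivity)
      (fun k => by
        have := hS.exists_codim_form_le hn hZp hZm k
        rwa [hZ] at this)
  refine ⟨twoSided Lp Lm, ⟨?_, ?_, ?_, ?_, ?_⟩, ?_⟩
  · intro k hk
    obtain ⟨j, rfl⟩ : ∃ j : ℕ, k = (j : ℤ) + 1 := ⟨(k - 1).toNat, by omega⟩
    rw [twoSided_succ]
    exact hp0 j
  · intro k hk
    obtain ⟨j, rfl⟩ : ∃ j : ℕ, k = -((j : ℤ) + 1) := ⟨(-k - 1).toNat, by omega⟩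
    rw [twoSided_neg_succ, neg_lt_zero]
    exact hm0 j
  · intro k hk k' hk' hkk
    rw [mem_Ici] at hk hk'
    obtain ⟨j, rfl⟩ : ∃ j : ℕ, k = (j : ℤ) + 1 := ⟨(k - 1).toNat, by omega⟩
    obtain ⟨j', rfl⟩ : ∃ j : ℕ, k' = (j : ℤ) + 1 := ⟨(k' - 1).toNat, by omega⟩
    rw [twoSided_succ, twoSided_succ]
    exact hpm (by omega)
  · intro k hk k' hk' hkk
    rw [mem_Iic] at hk hk'
    obtain ⟨j, rfl⟩ : ∃ j : ℕ, k = -((j : ℤ) + 1) := ⟨(-k - 1).toNat, by omega⟩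
    obtain ⟨j', rfl⟩ : ∃ j : ℕ, k' = -((j : ℤ) + 1) := ⟨(-k' - 1).toNat, by omega⟩
    rw [twoSided_neg_succ, twoSided_neg_succ, neg_le_neg_iff]
    exact hmm (by omega)
  · intro t ht
    rcases lt_or_gt_of_ne ht with hneg | hpos
    · have hset : {k : ℤ | k ≠ 0 ∧ twoSided Lp Lm k = t} =
          (fun j : ℕ => -((j : ℤ) + 1)) '' {j | Lm j = -t} := by
        ext k
        constructor
        · rintro ⟨hk0, hk⟩
          rcases lt_or_gt_of_ne hk0 with h | h
          · obtain ⟨j, rfl⟩ : ∃ j : ℕ, k = -((j : ℤ) + 1) := ⟨(-k - 1).toNat, by omega⟩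
            rw [twoSided_neg_succ] at hk
            exact ⟨j, by rw [mem_ofPred_eq]; linarith, rfl⟩
          · obtain ⟨j, rfl⟩ : ∃ j : ℕ, k = (j : ℤ) + 1 := ⟨(k - 1).toNat, by omega⟩
            rw [twoSided_succ] at hk
            linarith [hp0 j]
        · rintro ⟨j, hj, rfl⟩
          rw [mem_ofPred_eq] at hj
          refine ⟨by dsimp only; omega, ?_⟩
          rw [twoSided_neg_succ, hj, neg_neg]
      -- A negative eigenvalue `t` corresponds to the characteristic value `-t` of `-weightOp`.
      have heig : Module.End.eigenspace ((-weightOp n hn N β d P :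
          momentFree n →L[ℂ] momentFree n) : Module.End ℂ (momentFree n)) (((-t)⁻¹ : ℝ) : ℂ) =
          Module.End.eigenspace (weightOp n hn N β d P : Module.End ℂ (momentFree n))
            ((t⁻¹ : ℝ) : ℂ) := by
        rw [ContinuousLinearMap.toLinearMap_neg, eigenspace_neg, inv_neg, Complex.ofReal_neg,
          neg_neg]
      have hfd := hT.neg.finiteDimensional_eigenspace (isSymmetric_neg hTs)
        (inv_pos.2 (neg_pos.2 hneg))
      rw [heig] at hfd
      rw [hset, Function.Injective.encard_image (fun i j hij => by simpa using hij),
        hme _ (neg_pos.2 hneg), charMult, heig, eigenMult_eq hn ht hfd]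
    · have hset : {k : ℤ | k ≠ 0 ∧ twoSided Lp Lm k = t} =
          (fun j : ℕ => (j : ℤ) + 1) '' {j | Lp j = t} := by
        ext k
        constructor
        · rintro ⟨hk0, hk⟩
          rcases lt_or_gt_of_ne hk0 with h | h
          · obtain ⟨j, rfl⟩ : ∃ j : ℕ, k = -((j : ℤ) + 1) := ⟨(-k - 1).toNat, by omega⟩
            rw [twoSided_neg_succ] at hk
            linarith [hm0 j]
          · obtain ⟨j, rfl⟩ : ∃ j : ℕ, k = (j : ℤ) + 1 := ⟨(k - 1).toNat, by omega⟩
            rw [twoSided_succ] at hk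
            exact ⟨j, hk, rfl⟩
        · rintro ⟨j, hj, rfl⟩
          refine ⟨by dsimp only; omega, ?_⟩
          rw [twoSided_succ]
          exact hj
      have hfd := hT.finiteDimensional_eigenspace hTs (inv_pos.2 hpos)
      rw [hset, Function.Injective.encard_image (fun i j hij => by simpa using hij),
        hpe t hpos, charMult, eigenMult_eq hn ht hfd]
  · choose τ hτ0 hτ1 hτ2 using hlim
    -- `Lp` and `Lm` are numbered from `0`, the eigenvalues from `±1`; hence the shift by one in
    -- `l`.
    refine ⟨fun l => τ (l - 1), fun l hl => ⟨hτ0 _, ?_, ?_⟩⟩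
    · have hl1 := (Finset.mem_Icc.1 hl).1
      have e1 : ∀ k : ℕ, twoSided Lp Lm ((l : ℤ) + k * ((N : ℤ) - 1)) =
          Lp (l - 1 + k * (N - 1)) := fun k => by
        rw [← twoSided_succ Lp Lm]
        congr 1
        push_cast [Nat.cast_sub hl1, Nat.cast_sub (by omega : 1 ≤ N)]
        ring
      simp only [e1]
      have := isEquivalent_of_tendsto_mul hq0 (hτ0 (l - 1)).ne' (fun k => 2 * (k : ℤ))
        (u := fun k => Lp (l - 1 + k * (N - 1))) (by exact_mod_cast hτ1 (l - 1))
      simpa only [neg_mul] using this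
    · have hl1 := (Finset.mem_Icc.1 hl).1
      have e1 : ∀ k : ℕ, twoSided Lp Lm (-((l : ℤ) + numNeg N m β d + k * ((N : ℤ) - 1))) =
          -Lm (l - 1 + numNeg N m β d + k * (N - 1)) := fun k => by
        rw [← twoSided_neg_succ Lp Lm]
        congr 1
        push_cast [Nat.cast_sub hl1, Nat.cast_sub (by omega : 1 ≤ N)]
        ring
      simp only [e1]
      have h2 := (hτ2 (l - 1)).neg
      have := isEquivalent_of_tendsto_mul hq0 (neg_ne_zero.2 (hτ0 (l - 1)).ne')
        (fun k => 2 * (k : ℤ) + 1) (u := fun k => -Lm (l - 1 + numNeg N m β d + k * (N - 1)))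
        (by
          refine h2.congr fun k => ?_
          rw [neg_mul]
          norm_cast)
      refine this.congr_right (Eventually.of_forall fun k => ?_)
      dsimp only
      congr 2
      ring
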